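/- \textbf{Setting.} Let $\mathcal X,\mathcal A$ be finite nonempty sets and $H\in\mathbb N$ a horizon. Write $y=(t,x,a)$ for a triple in $\{0,\dots,H-1\}\times\mathcal X\times\mathcal A$. An outcome is a pair $o=(r,x')\in\{0,1\}\times\mathcal X$. An MDP $\mathcal M$ is given by an outcome distribution $\mathcal P^O_{y}$ for each $y$ (at $t=H-1$ the component $x'$ is the label of a dummy terminal state). In an episode, $x_0$ is drawn from a fixed initial distribution $\rho$ on $\mathcal X$, and for $t=0,\dots,H-1$ an action $a_t\in\mathcal A$ is chosen and $(r_{t+1},x_{t+1})$ is drawn from $\mathcal P^O_{t,x_t,a_t}$. \textbf{Dirichlet prior.} The distributions $\mathcal P^O_{y}$ are independent over all $y$, with $\mathcal P^O_y\sim\mathrm{Dirichlet}(\alpha_{0,y})$, $\alpha_{0,y}\in\mathbb R_{\ge 0}^{2|\mathcal X|}$, where coordinates with zero parameter vanish almost surely, and there is $\beta\ge 2$ with $\mathbf 1^T\alpha_{0,y}=\beta$ for all $y$. \textbf{Operators.} For $Q:\mathcal X\times\mathcal A\to\mathbb R$ let $V_Q(r,x')=r+\max_{a'}Q(x',a')$,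 $\mathrm{Span}(V_Q)=\max V_Q-\min V_Q$, and let the true Bellman update be $$F_{\mathcal M,t}Q(x,a)=\sum_{o}\mathcal P^O_{t,x,a}(o)\,V_Q(o).$$ Let $\mathcal H_{\ell-1}$ be the history of states, actions and rewards of episodes $1,\dots,\ell-1$, let $D_{\ell-1}(t,x,a)$ be the multiset of outcomes $(r_{t+1}^k,x_{t+1}^k)$ over the episodes $k<\ell$ with $x_t^k=x$, $a_t^k=a$, and let $n_\ell(t,x,a)$ be its cardinality. For parameters $\bar\theta$ (a real number $\bar\theta_y$ for each $y$), $v>0$ and $\lambda>0$, put $\sigma_\ell^2(y)=\left(\frac1\lambda+\frac{n_\ell(y)}{v}\right)^{-1}$. The RLSVI Bellman update is $$F_{\ell,t}Q(x,a)=\sigma_\ell^2(y)\Big(\frac{\bar\theta_{y}}{\lambda}+\frac1v\sum_{o\in D_{\ell-1}(y)}V_Q(o)\Big)+w_\ell(y),\qquad y=(t,x,a),$$ where $w_\ell(y)=\sigma_\ell(y)\xi_\ell(y)$ and the $\xi_\ell(y)\sim N(0,1)$ are independent over $\ell$ and $y$ and independent of $\mathcal M$; the $\xi_\ell(y)$ are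 also independent of $\mathcal H_{\ell-1}$. In each episode $\ell$ the RLSVI agent computes $Q_{\ell,H}=0$, $Q_{\ell,t}=F_{\ell,t}Q_{\ell,t+1}$ for $t<H$, and acts greedily, $a_t^\ell\in\arg\max_a Q_{\ell,t}(x_t^\ell,a)$ (ties broken by any fixed measurable rule). \textbf{Stochastic optimism.} $X\succeq_{SO}Y$ means $\mathbb E[u(X)]\ge\mathbb E[u(Y)]$ for every convex increasing (that is, nondecreasing) $u:\mathbb R\to\mathbb R$, where the expectations are well defined in $(-\infty,\infty]$. \textbf{Lemma (Stochastically optimistic operators).} Suppose the Dirichlet prior assumption holds and RLSVI is applied with parameters $(\bar\theta,v,\lambda)$ satisfying $v/\lambda=\beta$. Let $Q:\mathcal X\times\mathcal A\to\mathbb R$ be fixed with $\mathrm{Span}(V_Q)^2\le v$ and $\max_{r,x'}V_Q(r,x')\le\min_{y}\bar\theta_{y}$. Then for every episode $\ell\ge1$, every history $\mathcal H_{\ell-1}$ of positive probability, every $t\in\{0,\dots,H-1\}$ and every $(x,a)\in\mathcal X\times\mathcal A$, $$F_{\ell,t}Q(x,a)\mid\mathcal H_{\ell-1}\ \succeq_{SO}\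 F_{\mathcal M,t}Q(x,a)\mid\mathcal H_{\ell-1}.$$ -/

import Mathlib

open MeasureTheory ProbabilityTheory
open scoped ENNReal

noncomputable section

/-! ### Stochastic optimism -/

/-- Expectation with values in `[-∞, ∞]`: the integral of the positive part minus the integral of
the negative part. -/
def extExpectation {Ω : Type*} [MeasurableSpace Ω] (μ : Measure Ω) (f : Ω → ℝ) : EReal :=
  ((∫⁻ ω, ENNReal.ofReal (f ω) ∂μ : ℝ≥0∞) : EReal) -
    ((∫⁻ ω, ENNReal.ofReal (-f ω) ∂μ : ℝ≥0∞) : EReal)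

/-- `X ⪰_SO Y` under the law `μ`: `E[u(X)] ≥ E[u(Y)]` for all convex increasing `u : ℝ → ℝ`, both
expectations being well defined in `(-∞, ∞]` (the negative parts are integrable). -/
def StochOptimistic {Ω : Type*} [MeasurableSpace Ω] (μ : Measure Ω) (X Y : Ω → ℝ) : Prop :=
  ∀ u : ℝ → ℝ, ConvexOn ℝ Set.univ u → Monotone u →
    (∫⁻ ω, ENNReal.ofReal (-u (X ω)) ∂μ) ≠ ∞ ∧
    (∫⁻ ω, ENNReal.ofReal (-u (Y ω)) ∂μ) ≠ ∞ ∧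
    extExpectation μ (fun ω => u (Y ω)) ≤ extExpectation μ (fun ω => u (X ω))

/-! ### Dirichlet distribution -/

/-- The law `Gamma(a, 1)`, with the usual convention that `Gamma(0, 1)` is the point mass at `0`. -/
def gammaLaw (a : ℝ) : Measure ℝ :=
  if a = 0 then Measure.dirac 0 else gammaMeasure a 1

/-- `Dirichlet(α)`: the law of `G / ∑ j, G j`, where the `G i ∼ Gamma(α i, 1)` are independent.
A coordinate with `α i = 0` vanishes almost surely. -/
def dirichlet {ι : Type*} [Fintype ι] (α : ι → ℝ) : Measure (ι → ℝ) :=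
  (Measure.pi fun i => gammaLaw (α i)).map fun g i => g i / ∑ j, g j

/-! ### Time-inhomogeneous episodes -/

/-- An outcome `o = (r, x')`: a reward in `{0, 1}` and a next state. -/
abbrev Outcome (X : Type*) := Fin 2 × X

/-- A triple `y = (t, x, a)` of a timestep, a state and an action. -/
abbrev Triple (H : ℕ) (X A : Type*) := Fin H × X × A

/-- The outcome distributions `(t, x, a) ↦ (o ↦ 𝒫ᴼ_{t,x,a}(o))` of an MDP. -/
abbrev Env (H : ℕ) (X A : Type*) := Triple H X A → Outcome X → ℝ

/-- The record of an episode: initial state `x₀`, actions `a₀, …, a_{H-1}`, and outcomes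
`(r₁, x₁), …, (r_H, x_H)`, the one at index `t` being `(r_{t+1}, x_{t+1})`. -/
abbrev Episode (H : ℕ) (X A : Type*) := X × (Fin H → A) × (Fin H → Outcome X)

/-- The history of the first `n` episodes. -/
abbrev History (H : ℕ) (X A : Type*) (n : ℕ) := Fin n → Episode H X A

section Model

variable {H : ℕ} {X A : Type*}

/-- The state `x_t` of an episode. -/
def Episode.state (e : Episode H X A) (t : Fin H) : X :=
  match t with
  | ⟨0, _⟩ => e.1
  | ⟨s + 1, hs⟩ => (e.2.2 ⟨s, Nat.lt_of_succ_lt hs⟩).2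

/-- The action `a_t` of an episode. -/
def Episode.action (e : Episode H X A) (t : Fin H) : A := e.2.1 t

/-- The outcome `(r_{t+1}, x_{t+1})` of an episode. -/
def Episode.outcome (e : Episode H X A) (t : Fin H) : Outcome X := e.2.2 t

/-- Independent priors `𝒫ᴼ_y ∼ Dirichlet(α₀ y)` on the outcome distributions. -/
def priorLaw [Fintype X] [Fintype A] (α₀ : Triple H X A → Outcome X → ℝ) :
    Measure (Env H X A) :=
  Measure.pi fun y => dirichlet (α₀ y)

/-- `V_Q(r, x') = r + max_a Q(x', a)`. -/
def outcomeValue [Fintype A] [Nonempty A] (Q : X → A → ℝ) (o : Outcome X) : ℝ :=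
  ((o.1 : ℕ) : ℝ) + Finset.univ.sup' Finset.univ_nonempty (Q o.2)

/-- `Span(V) = max V - min V`. -/
def valueSpan {ι : Type*} [Fintype ι] [Nonempty ι] (V : ι → ℝ) : ℝ :=
  Finset.univ.sup' Finset.univ_nonempty V - Finset.univ.inf' Finset.univ_nonempty V

/-- True Bellman operator:
`F_{M,t} Q (x, a) = E[r_{t+1} + max_{a'} Q(x_{t+1}, a') | M, x_t = x, a_t = a]`. -/
def trueBellman [Fintype X] [Fintype A] [Nonempty A] (M : Env H X A) (t : Fin H)
    (Q : X → A → ℝ) (x : X) (a : A) : ℝ :=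
  ∑ o, M (t, x, a) o * outcomeValue Q o

/-! ### RLSVI with Gaussian noise and a tabular representation -/

variable [DecidableEq X] [DecidableEq A]

/-- The episodes with index `< k` in which action `a` was chosen in state `x` at time `t`, where
`y = (t, x, a)`. They index the data set `D(y)` available at the start of episode number `k`
(counted from `0`), with multiplicities. -/
def visits {n : ℕ} (h : History H X A n) (k : ℕ) (y : Triple H X A) : Finset (Fin n) :=
  Finset.univ.filter fun j =>
    (j : ℕ) < k ∧ (h j).state y.1 = y.2.1 ∧ (h j).action y.1 = y.2.2

/-- `σ²(y) = (1/λ + n(y)/v)⁻¹`, where `n(y)` is the number of visits to `y` before episode `k`. -/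
def noiseVar {n : ℕ} (v lam : ℝ) (h : History H X A n) (k : ℕ) (y : Triple H X A) : ℝ :=
  (1 / lam + ((visits h k y).card : ℝ) / v)⁻¹

/-- Bellman operator of RLSVI in episode number `k` (counted from `0`): the data are those of the
episodes before `k`, and the noise is `w(y) = σ(y) ξ(y)`. -/
def rlsviBellman [Fintype A] [Nonempty A] {n : ℕ} (θbar : Triple H X A → ℝ) (v lam : ℝ)
    (h : History H X A n) (k : ℕ) (ξ : Triple H X A → ℝ) (t : Fin H)
    (Q : X → A → ℝ) (x : X) (a : A) : ℝ :=
  noiseVar v lam h k (t, x, a) *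
      (θbar (t, x, a) / lam +
        (1 / v) * ∑ j ∈ visits h k (t, x, a), outcomeValue Q ((h j).outcome t)) +
    √(noiseVar v lam h k (t, x, a)) * ξ (t, x, a)

/-- The sequence `Q_0, …, Q_H` sampled by RLSVI in episode number `k`: `Q_H = 0` and `Q_t` is the
RLSVI Bellman update of `Q_{t+1}`. -/
def rlsviQ [Fintype A] [Nonempty A] {n : ℕ} (θbar : Triple H X A → ℝ) (v lam : ℝ)
    (h : History H X A n) (k : ℕ) (ξ : Triple H X A → ℝ) (t : Fin (H + 1)) : X → A → ℝ :=
  Fin.reverseInduction (motive := fun _ => X → A → ℝ) (fun _ _ => 0)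
    (fun s Q => rlsviBellman θbar v lam h k ξ s Q) t

/-- The policy of RLSVI in episode number `k`: greedy with respect to `Q_t`, where `greedy` selects
a maximizing action. -/
def rlsviPolicy [Fintype A] [Nonempty A] {n : ℕ} (greedy : (A → ℝ) → A)
    (θbar : Triple H X A → ℝ) (v lam : ℝ) (h : History H X A n) (k : ℕ)
    (ξ : Triple H X A → ℝ) (t : Fin H) (x : X) : A :=
  greedy (rlsviQ θbar v lam h k ξ t.castSucc x)

/-- The probability of the episode `e` under initial distribution `ρ`, policy `π` and outcome
distributions `M`: `x₀ ∼ ρ`, `a_t = π_t(x_t)` and `(r_{t+1}, x_{t+1}) ∼ M(t, x_t, a_t)`. -/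
def episodeProb (ρ : PMF X) (π : Fin H → X → A) (M : Env H X A) (e : Episode H X A) : ℝ≥0∞ :=
  ρ e.1 * ∏ t, if e.action t = π t (e.state t)
    then ENNReal.ofReal (M (t, e.state t, e.action t) (e.outcome t)) else 0

/-- The probability that the first `n` episodes are `h`, given the outcome distributions `M` and
the noise variables `ξ k` used by RLSVI in episode `k`. -/
def historyProb [Fintype A] [Nonempty A] {n : ℕ} (ρ : PMF X) (greedy : (A → ℝ) → A)
    (θbar : Triple H X A → ℝ) (v lam : ℝ) (M : Env H X A)
    (ξ : Fin (n + 1) → Triple H X A → ℝ) (h : History H X A n) : ℝ≥0∞ :=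
  ∏ k : Fin n,
    episodeProb ρ (rlsviPolicy greedy θbar v lam h (k : ℕ) (ξ k.castSucc)) M (h k)

/-- Joint law of `(M, ξ, h)`: the outcome distributions `M ∼ priorLaw α₀`, independent standard
normal noise variables `ξ k y` for the episodes `k = 0, …, n`, independent of `M`, and the history
`h` of the first `n` episodes, generated by RLSVI interacting with `M`. -/
def rlsviLaw [Fintype X] [Fintype A] [Nonempty A] [MeasurableSpace X] [MeasurableSpace A]
    (ρ : PMF X) (greedy : (A → ℝ) → A) (α₀ : Triple H X A → Outcome X → ℝ)
    (θbar : Triple H X A → ℝ) (v lam : ℝ) (n : ℕ) :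
    Measure (Env H X A × (Fin (n + 1) → Triple H X A → ℝ) × History H X A n) :=
  ((priorLaw α₀).prod
    ((Measure.pi fun _ => Measure.pi fun _ => gaussianReal 0 1).prod Measure.count)).withDensity
    fun ω => historyProb ρ greedy θbar v lam ω.1 ω.2.1 ω.2.2

end Model

end

/-!
Given the history, the outcome distribution at `y = (t, x, a)` is `Dirichlet(α)`, where `α` is the
prior parameter plus the outcome counts, with total mass `N = β + n(y)`; and the RLSVI update is
Gaussian with variance `v / N`, because `v / λ = β`, and with mean
`(β θ̄ + ∑ V(o)) / N`, which is at least the posterior mean `m` of the true update `p ⬝ V` since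
`θ̄ ≥ max V`. So it suffices that `p ⬝ V` is dominated in the convex order by a Gaussian variable
with the same mean `m` and variance `s ^ 2 / N`, where `s = √v` bounds the span of `V`
(`lintegral_dirichlet_le_gaussian`).

The domination is proved by following the Pólya urn. Revealing one draw from `p ∼ Dirichlet(α)`
replaces `α` by `α + e_o` with probability `α_o / N` and moves the mean of `p ⬝ V` by a centred
amount that lies in an interval of length `s / (N + 1)`. A centred variable with values in an
interval of length `c` is dominated by a centred Gaussian variable of variance `c ^ 2`
(`sum_le_lintegral_gaussian`); for a variable with two values this follows from the inequality
`Q(z) (1 - Q(z)) ≤ φ(z)` between the standard normal tail and density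
(`gaussianTail_mul_le_stdGaussianPDF`). As `(s / (N + 1)) ^ 2 ≤ s ^ 2 / N - s ^ 2 / (N + 1)`, the
Gaussian increments of all draws have total variance at most `s ^ 2 / N`. The process is stopped
after `k` draws, when the Dirichlet law has variance `O(1 / k)`, and `k` tends to infinity.

All facts about Dirichlet laws come from one identity, conjugacy for a single draw
(`dirichlet_withDensity_coord`): weighting `Dirichlet(α)` by `p_o` gives `(α_o / N)` times
`Dirichlet(α + e_o)`. It yields the urn decomposition, the mean and variance, and the posterior law
given a history (`lintegral_cond_rlsviLaw`). Its proof uses the representation by independent gamma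
variables, and that their sum is uncorrelated with functions of their normalization
(`lintegral_gammaPi_massNormalize_mul_sum`).
-/

/-! ### Products of measures with densities -/

theorem lintegral_pi_prod_eq_prod_lintegral {ι : Type*} [Fintype ι] {E : ι → Type*}
    [∀ i, MeasurableSpace (E i)] (μ : ∀ i, Measure (E i)) [∀ i, IsProbabilityMeasure (μ i)]
    {f : ∀ i, E i → ℝ≥0∞} (hf : ∀ i, Measurable (f i)) :
    ∫⁻ x, ∏ i, f i (x i) ∂Measure.pi μ = ∏ i, ∫⁻ x, f i x ∂μ i := by
  have hind : iIndepFun (fun i (x : ∀ i, E i) => f i (x i)) (Measure.pi μ) :=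
    iIndepFun_pi fun i => (hf i).aemeasurable
  rw [lintegral_prod_eq_prod_lintegral_of_indepFun Finset.univ _ hind
    (fun i => (hf i).comp (measurable_pi_apply i))]
  refine Finset.prod_congr rfl fun i _ => ?_
  exact (measurePreserving_eval μ i).lintegral_comp (hf i)

theorem pi_withDensity_prod {ι : Type*} [Fintype ι] {E : ι → Type*}
    [∀ i, MeasurableSpace (E i)] (μ ν : ∀ i, Measure (E i)) [∀ i, IsProbabilityMeasure (μ i)]
    [∀ i, IsProbabilityMeasure (ν i)] {f : ∀ i, E i → ℝ≥0∞} (hf : ∀ i, Measurable (f i))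
    (c : ι → ℝ≥0∞) (hc : ∀ i, c i ≠ ∞) (h : ∀ i, (μ i).withDensity (f i) = c i • ν i) :
    (Measure.pi μ).withDensity (fun x => ∏ i, f i (x i)) = (∏ i, c i) • Measure.pi ν := by
  classical
  have hfin : ∀ i, IsFiniteMeasure (c i • ν i) := fun i => ⟨by
    simpa using (hc i).lt_top⟩
  trans Measure.pi fun i => c i • ν i
  · refine (Measure.pi_eq fun s hs => ?_).symm
    rw [withDensity_apply _ (MeasurableSet.univ_pi hs), ← lintegral_indicator
      (MeasurableSet.univ_pi hs)]
    have : ∀ x : ∀ i, E i, (Set.univ.pi s).indicator (fun x => ∏ i, f i (x i)) x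
        = ∏ i, (s i).indicator (f i) (x i) := fun x => by
      by_cases hx : x ∈ Set.univ.pi s
      · rw [Set.indicator_of_mem hx]
        exact Finset.prod_congr rfl fun i _ => (Set.indicator_of_mem (hx i trivial) _).symm
      · rw [Set.indicator_of_notMem hx]
        simp only [Set.mem_univ_pi, not_forall] at hx
        obtain ⟨i, hi⟩ := hx
        exact (Finset.prod_eq_zero (Finset.mem_univ i) (Set.indicator_of_notMem hi _)).symm
    simp_rw [this]
    rw [lintegral_pi_prod_eq_prod_lintegral μ fun i => (hf i).indicator (hs i)]
    refine Finset.prod_congr rfl fun i _ => ?_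
    rw [lintegral_indicator (hs i), ← withDensity_apply _ (hs i), h i]
  · refine Measure.pi_eq fun s hs => ?_
    simp [Finset.prod_mul_distrib]

/-! ### Gamma laws -/

theorem isProbabilityMeasure_gammaLaw {a : ℝ} (ha : 0 ≤ a) :
    IsProbabilityMeasure (gammaLaw a) := by
  unfold gammaLaw
  split_ifs with h
  · infer_instance
  · exact isProbabilityMeasure_gammaMeasure (lt_of_le_of_ne ha (Ne.symm h)) one_pos

theorem gammaLaw_ae_nonneg (a : ℝ) : ∀ᵐ x ∂gammaLaw a, 0 ≤ x := by
  unfold gammaLaw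
  split_ifs with h
  · simp
  · rw [gammaMeasure, ae_withDensity_iff (by unfold gammaPDF; fun_prop)]
    refine ae_of_all _ fun x hx => ?_
    by_contra hneg
    exact hx (gammaPDF_of_neg (not_le.mp hneg))

theorem gammaLaw_ae_pos {a : ℝ} (ha : 0 < a) : ∀ᵐ x ∂gammaLaw a, 0 < x := by
  have h0 : ∀ᵐ x ∂gammaLaw a, x ≠ 0 := by
    rw [gammaLaw, if_neg ha.ne', gammaMeasure]
    exact (withDensity_absolutelyContinuous _ _).ae_le (Measure.ae_ne volume 0)
  filter_upwards [gammaLaw_ae_nonneg a, h0] with x h1 h2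
  exact lt_of_le_of_ne h1 (Ne.symm h2)

/-- Size-biasing a gamma law raises its shape parameter by one. -/
theorem gammaLaw_withDensity_id {a : ℝ} (ha : 0 ≤ a) :
    (gammaLaw a).withDensity (fun x => ENNReal.ofReal x) =
      ENNReal.ofReal a • gammaLaw (a + 1) := by
  rcases ha.eq_or_lt with rfl | ha
  · ext s hs
    rw [gammaLaw, if_pos rfl, withDensity_apply _ hs]
    have : ∫⁻ x in s, ENNReal.ofReal x ∂Measure.dirac (0 : ℝ) = 0 :=
      le_antisymm ((setLIntegral_le_lintegral _ _).trans (by simp)) zero_le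
    simp [this]
  · rw [gammaLaw, if_neg ha.ne', gammaLaw, if_neg (by positivity), gammaMeasure, gammaMeasure,
      ← withDensity_mul _ (by unfold gammaPDF; fun_prop) (by fun_prop),
      ← withDensity_smul _ (by unfold gammaPDF; fun_prop)]
    congr 1
    ext x
    rcases lt_or_ge x 0 with hx | hx
    · simp [gammaPDF_of_neg hx]
    · simp only [Pi.mul_apply, Pi.smul_apply, smul_eq_mul, gammaPDF_of_nonneg hx]
      rcases hx.eq_or_lt with rfl | hx
      · simp [Real.zero_rpow ha.ne']
      · rw [← ENNReal.ofReal_mul (by positivity), ← ENNReal.ofReal_mul ha.le]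
        congr 1
        have : a + 1 - 1 = (a - 1) + 1 := by ring
        rw [Real.Gamma_add_one ha.ne', this, Real.rpow_add_one hx.ne']
        have := Real.Gamma_pos_of_pos ha
        simp only [Real.one_rpow]
        field_simp

theorem gammaMeasure_map_mul {a c : ℝ} (ha : 0 < a) (hc : 0 < c) :
    (gammaMeasure a 1).map (fun x => c⁻¹ * x) = gammaMeasure a c := by
  ext s hs
  have hm : Measurable fun x : ℝ => c⁻¹ * x := by fun_prop
  rw [Measure.map_apply hm hs, gammaMeasure, gammaMeasure, withDensity_apply _ (hm hs),
    withDensity_apply _ hs, ← lintegral_indicator (hm hs), ← lintegral_indicator hs]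
  have key := Real.map_volume_mul_left (inv_ne_zero hc.ne')
  have h1 : ∫⁻ x, (s.indicator (gammaPDF a c)) x =
      ENNReal.ofReal c⁻¹ * ∫⁻ x, (s.indicator (gammaPDF a c)) (c⁻¹ * x) := by
    rw [← lintegral_map (g := fun x => c⁻¹ * x)
      (f := (s.indicator (gammaPDF a c)))
      (Measurable.indicator (by unfold gammaPDF; fun_prop) hs) hm,
      key, lintegral_smul_measure, smul_eq_mul, ← mul_assoc, ← ENNReal.ofReal_mul (by positivity)]
    simp [abs_of_pos hc, hc.ne']
  rw [h1, ← lintegral_const_mul' _ _ ENNReal.ofReal_ne_top]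
  refine lintegral_congr fun x => ?_
  by_cases hx : c⁻¹ * x ∈ s
  · rw [Set.indicator_of_mem (show x ∈ (fun x => c⁻¹ * x) ⁻¹' s from hx),
      Set.indicator_of_mem hx]
    rcases lt_or_ge x 0 with hx0 | hx0
    · rw [gammaPDF_of_neg hx0, gammaPDF_of_neg (mul_neg_of_pos_of_neg (by positivity) hx0)]
      simp
    · rw [gammaPDF_of_nonneg hx0, gammaPDF_of_nonneg (by positivity),
        ← ENNReal.ofReal_mul (by positivity)]
      congr 1
      rw [Real.mul_rpow (by positivity) hx0, Real.inv_rpow hc.le, Real.rpow_sub_one hc.ne']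
      have : 0 < c ^ a := by positivity
      have := Real.Gamma_pos_of_pos ha
      simp only [Real.one_rpow]
      field_simp
  · rw [Set.indicator_of_notMem (show x ∉ (fun x => c⁻¹ * x) ⁻¹' s from hx),
      Set.indicator_of_notMem hx, mul_zero]

/-- Exponential tilting of a gamma law rescales it. -/
theorem gammaLaw_withDensity_exp {a t : ℝ} (ha : 0 ≤ a) (ht : 0 < 1 + t) :
    (gammaLaw a).withDensity (fun x => ENNReal.ofReal (Real.exp (-(t * x)))) =
      ENNReal.ofReal ((1 + t) ^ (-a)) • (gammaLaw a).map (fun x => (1 + t)⁻¹ * x) := by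
  rcases ha.eq_or_lt with rfl | ha
  · ext s hs
    simp only [gammaLaw, if_true]
    rw [Measure.map_dirac' (by fun_prop), withDensity_apply _ hs,
      ← lintegral_indicator hs, lintegral_dirac]
    by_cases h0 : (0 : ℝ) ∈ s <;> simp [hs, h0]
  · rw [gammaLaw, if_neg ha.ne', gammaMeasure_map_mul ha ht, gammaMeasure, gammaMeasure,
      ← withDensity_mul _ (by unfold gammaPDF; fun_prop) (by fun_prop),
      ← withDensity_smul _ (by unfold gammaPDF; fun_prop)]
    congr 1
    ext x
    rcases lt_or_ge x 0 with hx | hx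
    · simp [gammaPDF_of_neg hx]
    · simp only [Pi.mul_apply, Pi.smul_apply, smul_eq_mul, gammaPDF_of_nonneg hx]
      have := Real.Gamma_pos_of_pos ha
      rw [← ENNReal.ofReal_mul (by positivity), ← ENNReal.ofReal_mul (by positivity)]
      congr 1
      have e : -((1 + t) * x) = -(1 * x) + -(t * x) := by ring
      rw [e, Real.exp_add, Real.rpow_neg ht.le]
      have : 0 < (1 + t) ^ a := by positivity
      simp only [Real.one_rpow]
      field_simp

/-! ### The Dirichlet law -/

section Dirichlet

open Filter Topology

variable {ι : Type*} [Fintype ι]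

theorem lintegral_Ioi_deriv_of_nonneg {g g' : ℝ → ℝ} {l : ℝ}
    (hderiv : ∀ x, 0 ≤ x → HasDerivAt g (g' x) x) (hpos : ∀ x, 0 < x → 0 ≤ g' x)
    (hg : Tendsto g atTop (𝓝 l)) :
    ∫⁻ x in Set.Ioi (0 : ℝ), ENNReal.ofReal (g' x) = ENNReal.ofReal (l - g 0) := by
  rw [← integral_Ioi_of_hasDerivAt_of_nonneg' (fun x hx => hderiv x hx) (fun x hx => hpos x hx) hg,
    ofReal_integral_eq_lintegral_ofReal
      (integrableOn_Ioi_deriv_of_nonneg' (fun x hx => hderiv x hx) (fun x hx => hpos x hx) hg)]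
  exact (ae_restrict_iff' measurableSet_Ioi).mpr (ae_of_all _ hpos)

theorem lintegral_Ioi_mul_exp_neg {S : ℝ} (hS : 0 < S) :
    ∫⁻ t in Set.Ioi (0 : ℝ), ENNReal.ofReal (S * Real.exp (-(t * S))) = 1 := by
  rw [lintegral_Ioi_deriv_of_nonneg (g := fun t => -Real.exp (-(t * S))) (l := -0)]
  · simp
  · intro x _
    refine ((hasDerivAt_id x).mul_const S).neg.exp.neg.congr_deriv ?_
    simp [mul_comm]
  · intro x _; positivity
  · refine (Real.tendsto_exp_neg_atTop_nhds_zero.comp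
      (tendsto_id.atTop_mul_const hS)).neg

theorem lintegral_Ioi_one_add_rpow {N : ℝ} (hN : 0 < N) :
    ∫⁻ t in Set.Ioi (0 : ℝ), ENNReal.ofReal ((1 + t) ^ (-N - 1)) = ENNReal.ofReal N⁻¹ := by
  rw [lintegral_Ioi_deriv_of_nonneg (g := fun t => -(N⁻¹ * (1 + t) ^ (-N))) (l := -(N⁻¹ * 0))]
  · simp
  · intro x hx
    have h1 : HasDerivAt (fun t : ℝ => 1 + t) 1 x := (hasDerivAt_id x).const_add 1
    refine ((h1.rpow_const (p := -N) (Or.inl (by positivity))).const_mul N⁻¹).neg.congr_deriv ?_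
    field_simp
  · intro x _; positivity
  · exact (((tendsto_rpow_neg_atTop hN).comp
      (tendsto_atTop_add_const_left _ 1 tendsto_id)).const_mul _).neg

/-- The law of independent `Gamma(α i, 1)` variables. -/
noncomputable def gammaPi (α : ι → ℝ) : Measure (ι → ℝ) := Measure.pi fun i => gammaLaw (α i)

/-- The normalization `g ↦ g / ∑ j, g j`. -/
noncomputable def massNormalize (g : ι → ℝ) : ι → ℝ := fun i => g i / ∑ j, g j

@[fun_prop]
theorem measurable_massNormalize : Measurable (massNormalize : (ι → ℝ) → ι → ℝ) := by
  unfold massNormalize; fun_prop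

theorem dirichlet_eq_map (α : ι → ℝ) : dirichlet α = (gammaPi α).map massNormalize := rfl

theorem massNormalize_const_mul {c : ℝ} (hc : c ≠ 0) (g : ι → ℝ) :
    massNormalize (fun i => c * g i) = massNormalize g := by
  ext i
  simp only [massNormalize, ← Finset.mul_sum]
  exact mul_div_mul_left _ _ hc

variable {α : ι → ℝ}

theorem isProbabilityMeasure_gammaPi (hα : ∀ i, 0 ≤ α i) : IsProbabilityMeasure (gammaPi α) := by
  have := fun i => isProbabilityMeasure_gammaLaw (hα i)
  exact Measure.pi.instIsProbabilityMeasure _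

theorem isProbabilityMeasure_dirichlet (hα : ∀ i, 0 ≤ α i) :
    IsProbabilityMeasure (dirichlet α) := by
  have := isProbabilityMeasure_gammaPi hα
  rw [dirichlet_eq_map]
  exact Measure.isProbabilityMeasure_map measurable_massNormalize.aemeasurable

theorem gammaPi_ae_nonneg (hα : ∀ i, 0 ≤ α i) : ∀ᵐ g ∂gammaPi α, ∀ i, 0 ≤ g i := by
  have := fun i => isProbabilityMeasure_gammaLaw (hα i)
  exact ae_all_iff.mpr fun i =>
    (Measure.quasiMeasurePreserving_eval (μ := fun i => gammaLaw (α i)) i).ae (gammaLaw_ae_nonneg _)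

theorem gammaPi_ae_sum_pos (hα : ∀ i, 0 ≤ α i) (hN : 0 < ∑ i, α i) :
    ∀ᵐ g ∂gammaPi α, 0 < ∑ i, g i := by
  have := fun i => isProbabilityMeasure_gammaLaw (hα i)
  obtain ⟨i, -, hi⟩ := Finset.exists_lt_of_sum_lt (s := Finset.univ) (f := fun _ : ι => (0 : ℝ))
    (g := α) (by simpa using hN)
  have hpos : ∀ᵐ g ∂gammaPi α, 0 < g i :=
    (Measure.quasiMeasurePreserving_eval (μ := fun i => gammaLaw (α i)) i).ae (gammaLaw_ae_pos hi)
  filter_upwards [gammaPi_ae_nonneg hα, hpos] with g h0 h1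
  exact Finset.sum_pos' (fun j _ => h0 j) ⟨i, Finset.mem_univ i, h1⟩

/-- The Dirichlet law is carried by the probability simplex. -/
theorem dirichlet_ae_mem_stdSimplex (hα : ∀ i, 0 ≤ α i) (hN : 0 < ∑ i, α i) :
    ∀ᵐ p ∂dirichlet α, p ∈ stdSimplex ℝ ι := by
  rw [dirichlet_eq_map]
  refine (ae_map_iff measurable_massNormalize.aemeasurable
    (isClosed_stdSimplex ℝ ι).measurableSet).mpr ?_
  filter_upwards [gammaPi_ae_nonneg hα, gammaPi_ae_sum_pos hα hN] with g h0 h1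
  refine ⟨fun i => div_nonneg (h0 i) h1.le, ?_⟩
  simp only [massNormalize, ← Finset.sum_div]
  exact div_self h1.ne'

theorem gammaPi_withDensity_exp (hα : ∀ i, 0 ≤ α i) {t : ℝ} (ht : 0 < 1 + t) :
    (gammaPi α).withDensity (fun g => ENNReal.ofReal (Real.exp (-(t * ∑ i, g i)))) =
      ENNReal.ofReal ((1 + t) ^ (-∑ i, α i)) •
        (gammaPi α).map (fun g i => (1 + t)⁻¹ * g i) := by
  have := fun i => isProbabilityMeasure_gammaLaw (hα i)
  have hprob : ∀ i, IsProbabilityMeasure ((gammaLaw (α i)).map fun x => (1 + t)⁻¹ * x) := fun i =>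
    Measure.isProbabilityMeasure_map (by fun_prop)
  have h := pi_withDensity_prod (fun i => gammaLaw (α i))
    (fun i => (gammaLaw (α i)).map fun x => (1 + t)⁻¹ * x)
    (f := fun _ x => ENNReal.ofReal (Real.exp (-(t * x)))) (fun _ => by fun_prop)
    (fun i => ENNReal.ofReal ((1 + t) ^ (-α i))) (fun _ => ENNReal.ofReal_ne_top)
    (fun i => gammaLaw_withDensity_exp (hα i) ht)
  rw [← Measure.pi_map_pi (fun i => by fun_prop)] at h
  have e1 : (fun g : ι → ℝ => ENNReal.ofReal (Real.exp (-(t * ∑ i, g i)))) =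
      fun g => ∏ i, ENNReal.ofReal (Real.exp (-(t * g i))) := by
    ext g
    rw [← ENNReal.ofReal_prod_of_nonneg (fun _ _ => (Real.exp_pos _).le), ← Real.exp_sum,
      Finset.mul_sum, Finset.sum_neg_distrib]
  have e2 : ENNReal.ofReal ((1 + t) ^ (-∑ i, α i)) = ∏ i, ENNReal.ofReal ((1 + t) ^ (-α i)) := by
    rw [← ENNReal.ofReal_prod_of_nonneg (fun _ _ => by positivity), ← Finset.sum_neg_distrib,
      Real.rpow_sum_of_pos ht]
  rw [e1, e2]
  exact h

/-- The total mass of independent gamma variables is uncorrelated with every function of the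
normalized vector. Rescaling gives
`E[F(g / S) S exp(-t S)] = (1 + t) ^ (-N - 1) E[F(g / S) S]`, and integrating this over `t > 0`
gives `E[F(g / S)] = N⁻¹ E[F(g / S) S]`. -/
theorem lintegral_gammaPi_massNormalize_mul_sum (hα : ∀ i, 0 ≤ α i) (hN : 0 < ∑ i, α i)
    {F : (ι → ℝ) → ℝ≥0∞} (hF : Measurable F) :
    ∫⁻ g, F (massNormalize g) * ENNReal.ofReal (∑ i, g i) ∂gammaPi α =
      ENNReal.ofReal (∑ i, α i) * ∫⁻ g, F (massNormalize g) ∂gammaPi α := by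
  have := isProbabilityMeasure_gammaPi hα
  have hFn : Measurable fun g : ι → ℝ => F (massNormalize g) := hF.comp measurable_massNormalize
  set N := ∑ i, α i with hNdef
  have key : ∀ t : ℝ, 0 < t → ∫⁻ g, F (massNormalize g) *
      ENNReal.ofReal ((∑ i, g i) * Real.exp (-(t * ∑ i, g i))) ∂gammaPi α =
      ENNReal.ofReal ((1 + t) ^ (-N - 1)) *
        ∫⁻ g, F (massNormalize g) * ENNReal.ofReal (∑ i, g i) ∂gammaPi α := fun t ht => by
    have ht1 : 0 < 1 + t := by positivity
    have hm : Measurable fun g : ι → ℝ => F (massNormalize g) * ENNReal.ofReal (∑ i, g i) := by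
      fun_prop
    have h := congrArg (fun μ => ∫⁻ g, F (massNormalize g) * ENNReal.ofReal (∑ i, g i) ∂μ)
      (gammaPi_withDensity_exp hα ht1)
    beta_reduce at h
    rw [lintegral_withDensity_eq_lintegral_mul _ (by fun_prop) hm, lintegral_smul_measure,
      lintegral_map hm (by fun_prop)] at h
    have e1 : ∀ g : ι → ℝ, F (massNormalize g) *
        ENNReal.ofReal ((∑ i, g i) * Real.exp (-(t * ∑ i, g i))) =
        ((fun g : ι → ℝ => ENNReal.ofReal (Real.exp (-(t * ∑ i, g i)))) *
          fun g : ι → ℝ => F (massNormalize g) * ENNReal.ofReal (∑ i, g i)) g := fun g => by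
      rw [ENNReal.ofReal_mul' (Real.exp_pos _).le, Pi.mul_apply]; ring
    rw [lintegral_congr e1, h]
    have e2 : ∀ g : ι → ℝ, F (massNormalize fun i => (1 + t)⁻¹ * g i) *
        ENNReal.ofReal (∑ i, (1 + t)⁻¹ * g i) = ENNReal.ofReal (1 + t)⁻¹ *
        (F (massNormalize g) * ENNReal.ofReal (∑ i, g i)) := fun g => by
      rw [massNormalize_const_mul (by positivity), ← Finset.mul_sum,
        ENNReal.ofReal_mul (by positivity)]
      ring
    rw [lintegral_congr e2, lintegral_const_mul _ hm, smul_eq_mul, ← mul_assoc,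
      ← ENNReal.ofReal_mul (by positivity), Real.rpow_sub_one ht1.ne', div_eq_mul_inv]
  -- both integrals over `t` are evaluated after exchanging the order of integration
  have swap : ∫⁻ g, F (massNormalize g) ∂gammaPi α = ENNReal.ofReal N⁻¹ *
      ∫⁻ g, F (massNormalize g) * ENNReal.ofReal (∑ i, g i) ∂gammaPi α := by
    rw [← lintegral_Ioi_one_add_rpow hN, ← lintegral_mul_const _ (by fun_prop),
      ← setLIntegral_congr_fun measurableSet_Ioi fun t ht => key t ht,
      lintegral_lintegral_swap (by fun_prop)]
    refine lintegral_congr_ae ?_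
    filter_upwards [gammaPi_ae_sum_pos hα hN] with g hg
    rw [lintegral_const_mul _ (by fun_prop), lintegral_Ioi_mul_exp_neg hg, mul_one]
  rw [swap, ← mul_assoc, ← ENNReal.ofReal_mul hN.le, mul_inv_cancel₀ hN.ne', ENNReal.ofReal_one,
    one_mul]

theorem add_single_nonneg {κ : Type*} [DecidableEq κ] {α : κ → ℝ} (hα : ∀ i, 0 ≤ α i) (o i : κ) :
    0 ≤ (α + Pi.single o (1 : ℝ) : κ → ℝ) i :=
  add_nonneg (hα i) ((Pi.single_nonneg (α := fun _ => ℝ) (i := o)).mpr zero_le_one i)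

theorem gammaPi_withDensity_coord [DecidableEq ι] (hα : ∀ i, 0 ≤ α i) (o : ι) :
    (gammaPi α).withDensity (fun g => ENNReal.ofReal (g o)) =
      ENNReal.ofReal (α o) • gammaPi (α + Pi.single o (1 : ℝ)) := by
  have := fun i => isProbabilityMeasure_gammaLaw (hα i)
  have := fun i => isProbabilityMeasure_gammaLaw (add_single_nonneg hα o i)
  have h := pi_withDensity_prod (fun i => gammaLaw (α i))
    (fun i => gammaLaw ((α + Pi.single o (1 : ℝ) : ι → ℝ) i))
    (f := fun i x => if i = o then ENNReal.ofReal x else 1) (fun i => by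
      split_ifs <;> fun_prop)
    (fun i => if i = o then ENNReal.ofReal (α i) else 1)
    (fun i => by split_ifs <;> simp) (fun i => by
      by_cases hi : i = o
      · subst hi
        simpa using gammaLaw_withDensity_id (hα i)
      · simp [hi, withDensity_const])
  simp only [Finset.prod_ite_eq', Finset.mem_univ, if_true] at h
  exact h

/-- Conjugacy of the Dirichlet family: observing the outcome `o` once raises the parameter of `o`
by one, and the marginal probability of `o` is `α o / ∑ i, α i`. -/
theorem dirichlet_withDensity_coord [DecidableEq ι] (hα : ∀ i, 0 ≤ α i) (hN : 0 < ∑ i, α i)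
    (o : ι) :
    (dirichlet α).withDensity (fun p => ENNReal.ofReal (p o)) =
      ENNReal.ofReal (α o / ∑ i, α i) • dirichlet (α + Pi.single o (1 : ℝ)) := by
  refine Measure.ext_of_lintegral _ fun F hF => ?_
  have hFn : Measurable fun g : ι → ℝ => F (massNormalize g) := hF.comp measurable_massNormalize
  rw [lintegral_withDensity_eq_lintegral_mul _ (by fun_prop) hF, lintegral_smul_measure,
    dirichlet_eq_map, dirichlet_eq_map, lintegral_map (by fun_prop) measurable_massNormalize,
    lintegral_map hF measurable_massNormalize]
  have h1 := lintegral_gammaPi_massNormalize_mul_sum hα hN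
    (F := (fun p : ι → ℝ => ENNReal.ofReal (p o)) * F) (by fun_prop)
  have h2 := congrArg (fun μ => ∫⁻ g, F (massNormalize g) ∂μ) (gammaPi_withDensity_coord hα o)
  beta_reduce at h2
  rw [lintegral_withDensity_eq_lintegral_mul _ (by fun_prop) hFn, lintegral_smul_measure] at h2
  have h3 : ∫⁻ g, ((fun p : ι → ℝ => ENNReal.ofReal (p o)) * F) (massNormalize g) *
      ENNReal.ofReal (∑ i, g i) ∂gammaPi α =
      ∫⁻ g, ((fun g : ι → ℝ => ENNReal.ofReal (g o)) * fun g => F (massNormalize g)) g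
        ∂gammaPi α := by
    refine lintegral_congr_ae ?_
    filter_upwards [gammaPi_ae_sum_pos hα hN] with g hg
    simp only [Pi.mul_apply]
    rw [mul_right_comm, ← ENNReal.ofReal_mul' hg.le, massNormalize, div_mul_cancel₀ _ hg.ne']
  rw [← h3, h1] at h2
  rw [div_eq_inv_mul, ENNReal.ofReal_mul (by positivity), smul_eq_mul, mul_assoc, ← smul_eq_mul
    (ENNReal.ofReal (α o)), ← h2, ← mul_assoc, ← ENNReal.ofReal_mul (by positivity),
    inv_mul_cancel₀ hN.ne', ENNReal.ofReal_one, one_mul]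

end Dirichlet

/-! ### Comparison of bounded variables with Gaussian variables -/

section GaussianComparison

open Filter Topology

/-- The density of the standard normal law. -/
noncomputable abbrev stdGaussianPDF (x : ℝ) : ℝ := gaussianPDFReal 0 1 x

theorem stdGaussianPDF_eq (x : ℝ) :
    stdGaussianPDF x = (√(2 * Real.pi))⁻¹ * Real.exp (-(x ^ 2 / 2)) := by
  simp [stdGaussianPDF, gaussianPDFReal, neg_div]

theorem continuous_stdGaussianPDF : Continuous stdGaussianPDF := by
  simp_rw [funext stdGaussianPDF_eq]; fun_prop

theorem hasDerivAt_stdGaussianPDF (x : ℝ) :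
    HasDerivAt stdGaussianPDF (-(x * stdGaussianPDF x)) x := by
  rw [funext stdGaussianPDF_eq]
  refine ((((hasDerivAt_id x).pow 2).div_const 2).neg.exp.const_mul
    (√(2 * Real.pi))⁻¹).congr_deriv ?_
  simp
  ring

theorem tendsto_stdGaussianPDF_atTop : Tendsto stdGaussianPDF atTop (𝓝 0) := by
  rw [funext stdGaussianPDF_eq]
  have h : Tendsto (fun x : ℝ => x ^ 2 / 2) atTop atTop :=
    (tendsto_pow_atTop two_ne_zero).atTop_div_const two_pos
  simpa using (Real.tendsto_exp_neg_atTop_nhds_zero.comp h).const_mul (√(2 * Real.pi))⁻¹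

theorem stdGaussianPDF_le_half (x : ℝ) : stdGaussianPDF x ≤ 1 / 2 := by
  rw [stdGaussianPDF_eq]
  have h2 : (2 : ℝ) ≤ √(2 * Real.pi) :=
    Real.le_sqrt_of_sq_le (by nlinarith [Real.pi_gt_three])
  have h3 : Real.exp (-(x ^ 2 / 2)) ≤ 1 := Real.exp_le_one_iff.mpr (by nlinarith [sq_nonneg x])
  calc (√(2 * Real.pi))⁻¹ * Real.exp (-(x ^ 2 / 2)) ≤ 2⁻¹ * 1 := by gcongr
    _ = 1 / 2 := by norm_num

/-- The upper tail probability of the standard normal law. -/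
noncomputable def gaussianTail (z : ℝ) : ℝ := (gaussianReal 0 1).real (Set.Ioi z)

theorem gaussianTail_eq_integral (z : ℝ) : gaussianTail z = ∫ x in Set.Ioi z, stdGaussianPDF x := by
  rw [gaussianTail, measureReal_def, gaussianReal_apply_eq_integral 0 one_ne_zero,
    ENNReal.toReal_ofReal (integral_nonneg fun x => gaussianPDFReal_nonneg 0 1 x)]

theorem gaussianTail_zero : gaussianTail 0 = 1 / 2 := by
  have hsymm : (gaussianReal 0 1).real (Set.Iio 0) = gaussianTail 0 := by
    have h := gaussianReal_map_neg (μ := 0) (v := 1)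
    rw [neg_zero] at h
    rw [gaussianTail, measureReal_def, measureReal_def]
    conv_rhs => rw [← h, Measure.map_apply measurable_neg measurableSet_Ioi]
    simp
  have : NullSingletonClass (gaussianReal 0 1) := nullSingletonClass_gaussianReal one_ne_zero
  have h1 : (gaussianReal 0 1).real (Set.Iio (0 : ℝ)) = (gaussianReal 0 1).real (Set.Iic 0) :=
    measureReal_congr Iio_ae_eq_Iic
  have h2 : (gaussianReal 0 1).real (Set.Iic (0 : ℝ))ᶜ = 1 - (gaussianReal 0 1).real (Set.Iic 0) :=
    probReal_compl_eq_one_sub measurableSet_Iic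
  rw [Set.compl_Iic] at h2
  change gaussianTail 0 = _ at h2
  linarith

theorem gaussianTail_eq_sub (z : ℝ) :
    gaussianTail z = 1 / 2 - ∫ x in (0 : ℝ)..z, stdGaussianPDF x := by
  have hi := (integrable_gaussianPDFReal 0 1)
  rw [← gaussianTail_zero, gaussianTail_eq_integral, gaussianTail_eq_integral,
    ← intervalIntegral.integral_Ioi_sub_Ioi' hi.integrableOn hi.integrableOn]
  ring

theorem hasDerivAt_gaussianTail (z : ℝ) : HasDerivAt gaussianTail (-stdGaussianPDF z) z := by
  rw [funext gaussianTail_eq_sub]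
  exact (intervalIntegral.integral_hasDerivAt_right
    (continuous_stdGaussianPDF.intervalIntegrable _ _)
    (continuous_stdGaussianPDF.stronglyMeasurableAtFilter _ _)
    continuous_stdGaussianPDF.continuousAt).const_sub _

theorem tendsto_gaussianTail_atTop : Tendsto gaussianTail atTop (𝓝 0) := by
  rw [funext gaussianTail_eq_sub]
  have h := intervalIntegral_tendsto_integral_Ioi 0
    ((integrable_gaussianPDFReal 0 1).integrableOn (s := Set.Ioi 0)) tendsto_id
  rw [← gaussianTail_eq_integral 0, gaussianTail_zero] at h
  have h2 := h.const_sub (1 / 2)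
  rwa [sub_self] at h2

theorem half_sub_gaussianTail_le {z : ℝ} (hz : 0 ≤ z) : 1 / 2 - gaussianTail z ≤ z / 2 := by
  rw [gaussianTail_eq_sub, sub_sub_cancel]
  calc ∫ x in (0 : ℝ)..z, stdGaussianPDF x ≤ ∫ _ in (0 : ℝ)..z, (1 / 2 : ℝ) :=
        intervalIntegral.integral_mono_on hz (continuous_stdGaussianPDF.intervalIntegrable _ _)
          (by simp) fun x _ => stdGaussianPDF_le_half x
    _ = z / 2 := by simp; ring

/-- `φ(z) ≥ Q(z) (1 - Q(z))` for `z ≥ 0`: the difference of the two sides vanishes at infinity and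
has derivative `φ(z) (1 - 2 Q(z) - z) ≤ 0`. -/
theorem gaussianTail_mul_le_stdGaussianPDF {z : ℝ} (hz : 0 ≤ z) :
    gaussianTail z * (1 - gaussianTail z) ≤ stdGaussianPDF z := by
  set f : ℝ → ℝ := fun z => stdGaussianPDF z - gaussianTail z * (1 - gaussianTail z) with hf
  have hd : ∀ z, HasDerivAt f (stdGaussianPDF z * (1 - 2 * gaussianTail z - z)) z := fun z => by
    refine ((hasDerivAt_stdGaussianPDF z).sub ((hasDerivAt_gaussianTail z).mul
      ((hasDerivAt_gaussianTail z).const_sub 1))).congr_deriv ?_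
    ring
  have hanti : AntitoneOn f (Set.Ici 0) := by
    refine antitoneOn_of_deriv_nonpos (convex_Ici 0)
      (fun z _ => (hd z).continuousAt.continuousWithinAt)
      (fun z _ => (hd z).differentiableAt.differentiableWithinAt) fun z hz => ?_
    rw [interior_Ici] at hz
    rw [(hd z).deriv]
    refine mul_nonpos_of_nonneg_of_nonpos (gaussianPDFReal_nonneg 0 1 z) ?_
    linarith [half_sub_gaussianTail_le (le_of_lt hz)]
  have hlim : Tendsto f atTop (𝓝 0) := by
    simpa using tendsto_stdGaussianPDF_atTop.sub
      (tendsto_gaussianTail_atTop.mul (tendsto_gaussianTail_atTop.const_sub 1))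
  have : 0 ≤ f z := by
    refine le_of_tendsto hlim ?_
    filter_upwards [eventually_ge_atTop z] with w hw
    exact hanti hz (hz.trans hw) hw
  simpa [hf] using this

theorem setIntegral_Ioi_gaussianReal (z : ℝ) :
    ∫ x in Set.Ioi z, x ∂gaussianReal 0 1 = stdGaussianPDF z := by
  rw [← integral_indicator measurableSet_Ioi, integral_gaussianReal_eq_integral_smul one_ne_zero]
  have e : ∀ x : ℝ, gaussianPDFReal 0 1 x • (Set.Ioi z).indicator (fun x : ℝ => x) x =
      (Set.Ioi z).indicator (fun x => x * stdGaussianPDF x) x := fun x => by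
    by_cases hx : x ∈ Set.Ioi z <;> simp [hx, mul_comm]
  simp_rw [e]
  rw [integral_indicator measurableSet_Ioi]
  have hid : Integrable (fun x : ℝ => x) (gaussianReal 0 1) :=
    (memLp_id_gaussianReal 1).integrable le_rfl
  have hint : Integrable (fun x => x * stdGaussianPDF x) := by
    rw [gaussianReal_of_var_ne_zero 0 one_ne_zero,
      integrable_withDensity_iff (measurable_gaussianPDF 0 1)
        (ae_of_all _ fun _ => gaussianPDF_lt_top)] at hid
    simpa only [toReal_gaussianPDF] using hid
  have h := integral_Ioi_of_hasDerivAt_of_tendsto' (a := z) (f := fun x => -stdGaussianPDF x)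
    (f' := fun x => x * stdGaussianPDF x) (m := -0)
    (fun x _ => (hasDerivAt_stdGaussianPDF x).neg.congr_deriv (neg_neg _)) hint.integrableOn
    tendsto_stdGaussianPDF_atTop.neg
  simpa using h

/-- For every `p ∈ [0, 1]` some event has probability `p` under the standard normal law and
carries at least `p (1 - p)` of the first moment. -/
theorem exists_gaussian_event {p : ℝ} (h0 : 0 ≤ p) (h1 : p ≤ 1) :
    ∃ S : Set ℝ, MeasurableSet S ∧ (gaussianReal 0 1).real S = p ∧
      p * (1 - p) ≤ ∫ x in S, x ∂gaussianReal 0 1 := by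
  have hid : Integrable (fun x : ℝ => x) (gaussianReal 0 1) :=
    (memLp_id_gaussianReal 1).integrable le_rfl
  have upper : ∀ p : ℝ, 0 ≤ p → p ≤ 1 / 2 → ∃ S : Set ℝ, MeasurableSet S ∧
      (gaussianReal 0 1).real S = p ∧ p * (1 - p) ≤ ∫ x in S, x ∂gaussianReal 0 1 := by
    intro p h0 h1
    rcases h0.eq_or_lt with rfl | h0
    · exact ⟨∅, MeasurableSet.empty, by simp, by simp⟩
    obtain ⟨b, hb0, hb⟩ : ∃ b, 0 ≤ b ∧ gaussianTail b < p :=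
      ((eventually_ge_atTop 0).and (tendsto_gaussianTail_atTop.eventually_lt_const h0)).exists
    have hcont : ContinuousOn gaussianTail (Set.Icc 0 b) := fun z _ =>
      (hasDerivAt_gaussianTail z).continuousAt.continuousWithinAt
    obtain ⟨z, hz, hzp⟩ := intermediate_value_Icc' hb0 hcont
      ⟨hb.le, by rw [gaussianTail_zero]; exact h1⟩
    refine ⟨Set.Ioi z, measurableSet_Ioi, hzp, ?_⟩
    rw [setIntegral_Ioi_gaussianReal, ← hzp]
    exact gaussianTail_mul_le_stdGaussianPDF hz.1
  rcases le_total p (1 / 2) with hp | hp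
  · exact upper p h0 hp
  · obtain ⟨S, hS, hSp, hSi⟩ := upper (1 - p) (by linarith) (by linarith)
    -- the reflected complement has probability `1 - (1 - p)` and the same first moment, because the
    -- law is symmetric and centred
    refine ⟨Neg.neg ⁻¹' Sᶜ, measurable_neg hS.compl, ?_, ?_⟩
    · have h := gaussianReal_map_neg (μ := 0) (v := 1)
      rw [neg_zero] at h
      rw [← map_measureReal_apply measurable_neg hS.compl]
      rw [show Measure.map Neg.neg (gaussianReal 0 1) = gaussianReal 0 1 from h,
        probReal_compl_eq_one_sub hS, hSp]
      ring
    · have h := gaussianReal_map_neg (μ := 0) (v := 1)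
      rw [neg_zero] at h
      have e : ∫ x in Neg.neg ⁻¹' Sᶜ, x ∂gaussianReal 0 1 = -∫ x in Sᶜ, x ∂gaussianReal 0 1 := by
        conv_rhs => rw [← h]
        rw [setIntegral_map hS.compl (by fun_prop) (by fun_prop), integral_neg, neg_neg]
      have e2 := integral_add_compl hS hid
      rw [integral_id_gaussianReal] at e2
      rw [e]
      linarith

end GaussianComparison

section OneStep

theorem ConvexOn.exists_supporting_slope {w : ℝ → ℝ} (hw : ConvexOn ℝ Set.univ w) (x : ℝ) :
    ∃ k : ℝ, ∀ y, w x + k * (y - x) ≤ w y := by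
  have hx : x ∈ interior (Set.univ : Set ℝ) := by simp
  refine ⟨derivWithin w (Set.Ioi x) x, fun y => ?_⟩
  rcases lt_trichotomy x y with h | rfl | h
  · have := hw.rightDeriv_le_slope_of_mem_interior hx (Set.mem_univ y) h
    rw [slope_def_field, le_div_iff₀ (sub_pos.mpr h)] at this
    linarith
  · simp
  · have h1 := hw.slope_le_leftDeriv_of_mem_interior (Set.mem_univ y) hx h
    have h2 := h1.trans (hw.leftDeriv_le_rightDeriv_of_mem_interior hx)
    rw [slope_def_field, div_le_iff₀ (sub_pos.mpr h)] at h2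
    linarith

theorem ConvexOn.measurable_real {w : ℝ → ℝ} (hw : ConvexOn ℝ Set.univ w) : Measurable w :=
  hw.locallyLipschitz.continuous.measurable

theorem ofReal_integral_le_lintegral_ofReal {Ω : Type*} [MeasurableSpace Ω] {μ : Measure Ω}
    {f : Ω → ℝ} (hf : Integrable f μ) :
    ENNReal.ofReal (∫ x, f x ∂μ) ≤ ∫⁻ x, ENNReal.ofReal (f x) ∂μ := by
  rw [integral_eq_lintegral_pos_part_sub_lintegral_neg_part hf]
  exact (ENNReal.ofReal_le_ofReal (sub_le_self _ ENNReal.toReal_nonneg)).trans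
    ENNReal.ofReal_toReal_le

theorem setIntegral_affine {μ : Measure ℝ} [IsProbabilityMeasure μ]
    (hμ : Integrable (fun x : ℝ => x) μ) (S : Set ℝ) (A B : ℝ) :
    ∫ x in S, (A + B * x) ∂μ = A * μ.real S + B * ∫ x in S, x ∂μ := by
  rw [integral_add (integrable_const A) (hμ.integrableOn.const_mul B), integral_const_mul]
  simp [mul_comm]

theorem integrable_id_gaussianReal (m : ℝ) (v : NNReal) :
    Integrable (fun x : ℝ => x) (gaussianReal m v) :=
  (memLp_id_gaussianReal 1).integrable le_rfl

/-- A variable with two values at distance `c` is dominated, in the convex order, by the Gaussian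
variable with the same mean and standard deviation `c`: test `w` against its supporting line at
the upper value on an event of the same probability as that value, and against the supporting line
at the lower value elsewhere. -/
theorem two_point_le_lintegral_gaussian {w : ℝ → ℝ} (hw : ConvexOn ℝ Set.univ w) {a c p : ℝ}
    (hc : 0 < c) (h0 : 0 ≤ p) (h1 : p ≤ 1) :
    ENNReal.ofReal ((1 - p) * w a + p * w (a + c)) ≤
      ∫⁻ x, ENNReal.ofReal (w (a + p * c + c * x)) ∂gaussianReal 0 1 := by
  classical
  obtain ⟨S, hS, hSp, hSi⟩ := exists_gaussian_event h0 h1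
  obtain ⟨ka, hka⟩ := hw.exists_supporting_slope a
  obtain ⟨kb, hkb⟩ := hw.exists_supporting_slope (a + c)
  have hk : ka ≤ kb := by
    have e1 := hka (a + c)
    have e2 := hkb a
    by_contra! hlt
    nlinarith
  have hid := integrable_id_gaussianReal 0 1
  set Aa := w a + ka * (p * c)
  set Ab := w (a + c) + kb * (p * c - c)
  set f : ℝ → ℝ := S.piecewise (fun x => Ab + (kb * c) * x) (fun x => Aa + (ka * c) * x) with hf
  have haff : ∀ (A B : ℝ) (T : Set ℝ), IntegrableOn (fun x => A + B * x) T (gaussianReal 0 1) :=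
    fun A B _ => ((integrable_const A).add (hid.const_mul B)).integrableOn
  have hfi : Integrable f (gaussianReal 0 1) := Integrable.piecewise hS (haff _ _ _) (haff _ _ _)
  have hle : ∀ x, f x ≤ w (a + p * c + c * x) := fun x => by
    by_cases hx : x ∈ S
    · rw [hf, Set.piecewise_eq_of_mem _ _ _ hx]
      refine le_trans (le_of_eq ?_) (hkb (a + p * c + c * x))
      simp only [Ab]; ring
    · rw [hf, Set.piecewise_eq_of_notMem _ _ _ hx]
      refine le_trans (le_of_eq ?_) (hka (a + p * c + c * x))
      simp only [Aa]; ring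
  have hint : ∫ x, f x ∂gaussianReal 0 1 = (Ab * p + (kb * c) * ∫ x in S, x ∂gaussianReal 0 1) +
      (Aa * (1 - p) - (ka * c) * ∫ x in S, x ∂gaussianReal 0 1) := by
    have hcompl := integral_add_compl hS hid
    rw [integral_id_gaussianReal] at hcompl
    rw [hf, integral_piecewise hS (haff _ _ _) (haff _ _ _),
      setIntegral_affine hid, setIntegral_affine hid, probReal_compl_eq_one_sub hS, hSp,
      eq_neg_of_add_eq_zero_right hcompl]
    ring
  calc ENNReal.ofReal ((1 - p) * w a + p * w (a + c))
      ≤ ENNReal.ofReal (∫ x, f x ∂gaussianReal 0 1) := by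
        refine ENNReal.ofReal_le_ofReal ?_
        rw [hint]
        have : 0 ≤ (kb - ka) * c * ((∫ x in S, x ∂gaussianReal 0 1) - p * (1 - p)) :=
          mul_nonneg (mul_nonneg (sub_nonneg.mpr hk) hc.le) (sub_nonneg.mpr hSi)
        simp only [Aa, Ab]
        linear_combination this
    _ ≤ ∫⁻ x, ENNReal.ofReal (f x) ∂gaussianReal 0 1 := ofReal_integral_le_lintegral_ofReal hfi
    _ ≤ _ := lintegral_mono fun x => ENNReal.ofReal_le_ofReal (hle x)

/-- A finitely supported variable with values in an interval of length `√v` is dominated, in the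
convex order, by the Gaussian variable with the same mean and variance `v`. -/
theorem sum_le_lintegral_gaussian {ι : Type*} [Fintype ι] {w : ℝ → ℝ}
    (hw : ConvexOn ℝ Set.univ w) {v : NNReal} (hv : v ≠ 0) {q z : ι → ℝ} (hq : ∀ i, 0 ≤ q i)
    (hq1 : ∑ i, q i = 1) {a : ℝ} (hz : ∀ i, a ≤ z i) (hz' : ∀ i, z i ≤ a + √v) :
    ENNReal.ofReal (∑ i, q i * w (z i)) ≤
      ∫⁻ x, ENNReal.ofReal (w x) ∂gaussianReal (∑ i, q i * z i) v := by
  set c : ℝ := √v with hcdef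
  have hc : 0 < c := Real.sqrt_pos.mpr (by positivity)
  set m := ∑ i, q i * z i with hm
  have hmap : gaussianReal m v = (gaussianReal 0 1).map (fun x => m + c * x) := by
    have h := gaussianReal_map_const_mul (μ := 0) (v := 1) c
    have h2 := congrArg (Measure.map (fun x => m + x)) h
    rw [Measure.map_map (by fun_prop) (by fun_prop), gaussianReal_map_const_add] at h2
    rw [show (fun x => m + c * x) = (fun x => m + x) ∘ fun x => c * x from rfl, h2]
    congr 1
    · simp
    · ext; simp [hcdef]
  set p := (m - a) / c with hp
  have hsum : ∑ i, q i * ((z i - a) / c) = p := by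
    rw [hp, hm]
    simp_rw [mul_div_assoc', mul_sub, ← Finset.sum_div, Finset.sum_sub_distrib, ← Finset.sum_mul,
      hq1, one_mul]
  have hθ0 : ∀ i, 0 ≤ (z i - a) / c := fun i => div_nonneg (sub_nonneg.mpr (hz i)) hc.le
  have hθ1 : ∀ i, (z i - a) / c ≤ 1 := fun i => (div_le_one hc).mpr (by linarith [hz' i])
  have hp0 : 0 ≤ p := hsum ▸ Finset.sum_nonneg fun i _ => mul_nonneg (hq i) (hθ0 i)
  have hp1 : p ≤ 1 := by
    rw [← hsum, ← hq1]
    exact Finset.sum_le_sum fun i _ => mul_le_of_le_one_right (hq i) (hθ1 i)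
  have hchord : ∀ i, w (z i) ≤ (1 - (z i - a) / c) * w a + (z i - a) / c * w (a + c) := fun i => by
    have h := hw.2 (Set.mem_univ a) (Set.mem_univ (a + c)) (sub_nonneg.mpr (hθ1 i)) (hθ0 i)
      (by ring)
    simp only [smul_eq_mul] at h
    refine le_trans (le_of_eq ?_) h
    congr 1
    field_simp
    ring
  have hmp : m = a + p * c := by rw [hp]; field_simp; ring
  rw [hmap, lintegral_map (hw.measurable_real.ennreal_ofReal) (by fun_prop), hmp]
  refine le_trans (ENNReal.ofReal_le_ofReal ?_) (two_point_le_lintegral_gaussian hw hc hp0 hp1)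
  calc ∑ i, q i * w (z i)
      ≤ ∑ i, q i * ((1 - (z i - a) / c) * w a + (z i - a) / c * w (a + c)) :=
        Finset.sum_le_sum fun i _ => mul_le_mul_of_nonneg_left (hchord i) (hq i)
    _ = (∑ i, q i) * w a + (∑ i, q i * ((z i - a) / c)) * (w (a + c) - w a) := by
        rw [Finset.sum_mul, Finset.sum_mul, ← Finset.sum_add_distrib]
        exact Finset.sum_congr rfl fun i _ => by ring
    _ = (1 - p) * w a + p * w (a + c) := by rw [hq1, hsum]; ring

theorem ofReal_le_lintegral_gaussian {w : ℝ → ℝ} (hw : ConvexOn ℝ Set.univ w) (m : ℝ) {v : NNReal}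
    (hv : v ≠ 0) : ENNReal.ofReal (w m) ≤ ∫⁻ x, ENNReal.ofReal (w x) ∂gaussianReal m v := by
  simpa using sum_le_lintegral_gaussian (ι := Unit) hw hv (q := fun _ => 1) (z := fun _ => m)
    (fun _ => zero_le_one) (by simp) (a := m) (fun _ => le_rfl)
    (fun _ => le_add_of_nonneg_right (Real.sqrt_nonneg _))

theorem lintegral_gaussianReal_add {f : ℝ → ℝ≥0∞} (hf : Measurable f) (m : ℝ) (v₁ v₂ : NNReal) :
    ∫⁻ x, f x ∂gaussianReal m (v₁ + v₂) =
      ∫⁻ y, ∫⁻ x, f (x + y) ∂gaussianReal m v₁ ∂gaussianReal 0 v₂ := by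
  have h := gaussianReal_conv_gaussianReal (m₁ := 0) (m₂ := m) (v₁ := v₂) (v₂ := v₁)
  rw [zero_add, add_comm v₂] at h
  rw [← h, Measure.lintegral_conv hf]
  simp_rw [add_comm]

end OneStep

/-! ### Moments of the Dirichlet law -/

section DirichletMoments

variable {ι : Type*} [Fintype ι] {α : ι → ℝ}

/-- Pólya urn decomposition: a Dirichlet law is the mixture of its posteriors after one draw. -/
theorem lintegral_dirichlet_eq_sum [DecidableEq ι] (hα : ∀ i, 0 ≤ α i) (hN : 0 < ∑ i, α i)
    {F : (ι → ℝ) → ℝ≥0∞} (hF : Measurable F) :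
    ∫⁻ p, F p ∂dirichlet α =
      ∑ o, ENNReal.ofReal (α o / ∑ i, α i) * ∫⁻ p, F p ∂dirichlet (α + Pi.single o (1 : ℝ)) := by
  have h : ∀ o, ENNReal.ofReal (α o / ∑ i, α i) *
      ∫⁻ p, F p ∂dirichlet (α + Pi.single o (1 : ℝ)) =
      ∫⁻ p, ENNReal.ofReal (p o) * F p ∂dirichlet α := fun o => by
    rw [← smul_eq_mul, ← lintegral_smul_measure, ← dirichlet_withDensity_coord hα hN o,
      lintegral_withDensity_eq_lintegral_mul _ (by fun_prop) hF]
    rfl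
  simp_rw [h]
  rw [← lintegral_finsetSum _ fun o _ => by fun_prop]
  refine lintegral_congr_ae ?_
  filter_upwards [dirichlet_ae_mem_stdSimplex hα hN] with p hp
  rw [← Finset.sum_mul, ← ENNReal.ofReal_sum_of_nonneg fun i _ => hp.1 i, hp.2,
    ENNReal.ofReal_one, one_mul]

theorem integral_dirichlet_coord_mul [DecidableEq ι] (hα : ∀ i, 0 ≤ α i) (hN : 0 < ∑ i, α i)
    (o : ι) (f : (ι → ℝ) → ℝ) :
    ∫ p, p o * f p ∂dirichlet α =
      α o / (∑ i, α i) * ∫ p, f p ∂dirichlet (α + Pi.single o (1 : ℝ)) := by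
  have h := congrArg (fun μ => ∫ p, f p ∂μ) (dirichlet_withDensity_coord hα hN o)
  beta_reduce at h
  rw [integral_withDensity_eq_integral_toReal_smul (by fun_prop) (by simp),
    integral_smul_measure, ENNReal.toReal_ofReal (div_nonneg (hα o) hN.le), smul_eq_mul] at h
  rw [← h]
  refine integral_congr_ae ?_
  filter_upwards [dirichlet_ae_mem_stdSimplex hα hN] with p hp
  rw [ENNReal.toReal_ofReal (hp.1 o), smul_eq_mul]

theorem sum_add_single [DecidableEq ι] (o : ι) :
    ∑ i, (α + Pi.single o (1 : ℝ) : ι → ℝ) i = ∑ i, α i + 1 := by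
  simp [Finset.sum_add_distrib]

theorem sum_add_single_mul [DecidableEq ι] (V : ι → ℝ) (o : ι) :
    ∑ i, (α + Pi.single o (1 : ℝ) : ι → ℝ) i * V i = ∑ i, α i * V i + V o := by
  simp [add_mul, Finset.sum_add_distrib, Pi.single_apply]

theorem integrable_dirichlet_of_continuous (hα : ∀ i, 0 ≤ α i) (hN : 0 < ∑ i, α i)
    {f : (ι → ℝ) → ℝ} (hf : Continuous f) : Integrable f (dirichlet α) := by
  have := isProbabilityMeasure_dirichlet hα
  obtain ⟨C, hC⟩ := (isCompact_stdSimplex ℝ ι).exists_bound_of_continuousOn hf.continuousOn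
  refine Integrable.of_bound hf.aestronglyMeasurable C ?_
  filter_upwards [dirichlet_ae_mem_stdSimplex hα hN] with p hp using hC p hp

theorem integral_dirichlet_sum_mul (hα : ∀ i, 0 ≤ α i) (hN : 0 < ∑ i, α i) (V : ι → ℝ) :
    ∫ p, ∑ i, p i * V i ∂dirichlet α = (∑ i, α i * V i) / ∑ i, α i := by
  classical
  rw [integral_finsetSum _ fun i _ => integrable_dirichlet_of_continuous hα hN (by fun_prop),
    Finset.sum_div]
  refine Finset.sum_congr rfl fun o _ => ?_
  have := isProbabilityMeasure_dirichlet (add_single_nonneg hα o)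
  rw [integral_dirichlet_coord_mul hα hN o fun _ => V o]
  simp
  ring

/-- The variance of `p ⬝ V` under a Dirichlet law of total mass `N` is at most
`(max V - min V) ^ 2 / (N + 1)`. -/
theorem integral_dirichlet_sq_le (hα : ∀ i, 0 ≤ α i) (hN : 0 < ∑ i, α i) {V : ι → ℝ} {a s : ℝ}
    (hV : ∀ i, a ≤ V i) (hV' : ∀ i, V i ≤ a + s) :
    ∫ p, (∑ i, p i * V i - (∑ i, α i * V i) / ∑ i, α i) ^ 2 ∂dirichlet α ≤
      s ^ 2 / (∑ i, α i + 1) := by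
  classical
  set N := ∑ i, α i with hNdef
  set m := (∑ i, α i * V i) / N with hm
  have hma : a ≤ m := by
    rw [hm, le_div_iff₀ hN, hNdef, Finset.mul_sum]
    exact Finset.sum_le_sum fun i _ => by nlinarith [hα i, hV i]
  have hmb : m ≤ a + s := by
    rw [hm, div_le_iff₀ hN, hNdef, Finset.mul_sum]
    exact Finset.sum_le_sum fun i _ => by nlinarith [hα i, hV' i]
  set W : ι → ℝ := fun i => V i - m with hW
  have hαW : ∑ i, α i * W i = 0 := by
    simp only [hW, mul_sub, Finset.sum_sub_distrib, ← Finset.sum_mul]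
    rw [← hNdef, hm]; field_simp; ring
  have hWs : ∀ i, W i ^ 2 ≤ s ^ 2 := fun i => by
    have h1 := hV i; have h2 := hV' i
    exact sq_le_sq' (by simp only [hW]; linarith) (by simp only [hW]; linarith)
  have e1 : ∫ p, (∑ i, p i * V i - m) ^ 2 ∂dirichlet α =
      ∫ p, ∑ o, W o * (p o * ∑ i, p i * W i) ∂dirichlet α := by
    refine integral_congr_ae ?_
    filter_upwards [dirichlet_ae_mem_stdSimplex hα hN] with p hp
    have : ∑ i, p i * V i - m = ∑ i, p i * W i := by
      simp only [hW, mul_sub, Finset.sum_sub_distrib, ← Finset.sum_mul, hp.2, one_mul]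
    rw [this, sq]
    nth_rewrite 1 [Finset.sum_mul]
    exact Finset.sum_congr rfl fun o _ => by ring
  rw [e1, integral_finsetSum _ fun i _ => integrable_dirichlet_of_continuous hα hN (by fun_prop)]
  have e2 : ∀ o, ∫ p, W o * (p o * ∑ i, p i * W i) ∂dirichlet α =
      α o / N * (W o ^ 2 / (N + 1)) := fun o => by
    rw [integral_const_mul, integral_dirichlet_coord_mul hα hN o (fun p => ∑ i, p i * W i),
      integral_dirichlet_sum_mul (add_single_nonneg hα o) (by rw [sum_add_single]; positivity),
      sum_add_single, sum_add_single_mul, hαW]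
    ring
  simp_rw [e2]
  calc ∑ o, α o / N * (W o ^ 2 / (N + 1)) ≤ ∑ o, α o / N * (s ^ 2 / (N + 1)) :=
        Finset.sum_le_sum fun o _ => mul_le_mul_of_nonneg_left
          (div_le_div_of_nonneg_right (hWs o) (by positivity)) (div_nonneg (hα o) hN.le)
    _ = s ^ 2 / (N + 1) := by
        rw [← Finset.sum_mul, ← Finset.sum_div, ← hNdef, div_self hN.ne', one_mul]

end DirichletMoments

/-! ### Gaussian domination of Dirichlet averages -/

section Polya

variable {ι : Type*} [Fintype ι]

theorem ConvexOn.exists_lipschitz_bound {w : ℝ → ℝ} (hw : ConvexOn ℝ Set.univ w) (a b : ℝ) :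
    ∃ K : ℝ, 0 ≤ K ∧ ∀ x y, a ≤ x → x ≤ b → a ≤ y → y ≤ b → w y ≤ w x + K * |y - x| := by
  choose k hk using hw.exists_supporting_slope
  have hmono : ∀ x y, x ≤ y → k x ≤ k y := fun x y hxy => by
    rcases hxy.eq_or_lt with rfl | hxy
    · rfl
    · have e1 := hk x y
      have e2 := hk y x
      by_contra! hlt
      nlinarith
  refine ⟨|k a| + |k b|, by positivity, fun x y hax hxb hay hyb => ?_⟩
  have h1 : |k y| ≤ |k a| + |k b| := by
    have := hmono a y hay
    have := hmono y b hyb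
    rw [abs_le]
    constructor
    · linarith [neg_abs_le (k a), abs_nonneg (k b)]
    · linarith [le_abs_self (k b), abs_nonneg (k a)]
  have h2 := hk y x
  have h3 : k y * (y - x) ≤ |k y| * |y - x| := by rw [← abs_mul]; exact le_abs_self _
  have h4 := mul_le_mul_of_nonneg_right h1 (abs_nonneg (y - x))
  linarith

/-- Concentration of the Dirichlet law: `E[w(p ⬝ V)]` exceeds `w(E[p ⬝ V])` by at most
`K (δ + s ^ 2 / (δ (N + 1)))`. -/
theorem lintegral_dirichlet_le_mean_add {α : ι → ℝ} (hα : ∀ i, 0 ≤ α i) (hN : 0 < ∑ i, α i)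
    {V : ι → ℝ} {a s : ℝ} (hV : ∀ i, a ≤ V i) (hV' : ∀ i, V i ≤ a + s)
    {w : ℝ → ℝ} (hw0 : ∀ x, 0 ≤ w x) {K : ℝ} (hK : 0 ≤ K)
    (hKw : ∀ x y, a ≤ x → x ≤ a + s → a ≤ y → y ≤ a + s → w y ≤ w x + K * |y - x|)
    {δ : ℝ} (hδ : 0 < δ) :
    ∫⁻ p, ENNReal.ofReal (w (∑ i, p i * V i)) ∂dirichlet α ≤
      ENNReal.ofReal (w ((∑ i, α i * V i) / ∑ i, α i)) +
        ENNReal.ofReal (K * (δ + s ^ 2 / (δ * (∑ i, α i + 1)))) := by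
  have := isProbabilityMeasure_dirichlet hα
  have hvar := integral_dirichlet_sq_le hα hN hV hV'
  set N := ∑ i, α i with hNdef
  set m := (∑ i, α i * V i) / N with hm
  have hconv : ∀ q ∈ stdSimplex ℝ ι, a ≤ ∑ i, q i * V i ∧ ∑ i, q i * V i ≤ a + s := fun q hq => by
    constructor
    · calc a = ∑ i, q i * a := by rw [← Finset.sum_mul, hq.2, one_mul]
        _ ≤ _ := Finset.sum_le_sum fun i _ => mul_le_mul_of_nonneg_left (hV i) (hq.1 i)
    · calc _ ≤ ∑ i, q i * (a + s) :=
            Finset.sum_le_sum fun i _ => mul_le_mul_of_nonneg_left (hV' i) (hq.1 i)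
        _ = a + s := by rw [← Finset.sum_mul, hq.2, one_mul]
  have hmm := hconv (fun i => α i / N) ⟨fun i => div_nonneg (hα i) hN.le, by
    rw [← Finset.sum_div, ← hNdef, div_self hN.ne']⟩
  have hme : ∑ i, α i / N * V i = m := by
    rw [hm, Finset.sum_div]; exact Finset.sum_congr rfl fun i _ => by ring
  rw [hme] at hmm
  have hint : Integrable (fun p : ι → ℝ => (∑ i, p i * V i - m) ^ 2) (dirichlet α) :=
    integrable_dirichlet_of_continuous hα hN (by fun_prop)
  have hint2 : Integrable (fun p : ι → ℝ => w m + K * (δ + (∑ i, p i * V i - m) ^ 2 / δ))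
      (dirichlet α) := integrable_dirichlet_of_continuous hα hN (by fun_prop)
  calc ∫⁻ p, ENNReal.ofReal (w (∑ i, p i * V i)) ∂dirichlet α
      ≤ ∫⁻ p, ENNReal.ofReal (w m + K * (δ + (∑ i, p i * V i - m) ^ 2 / δ)) ∂dirichlet α := by
        refine lintegral_mono_ae ?_
        filter_upwards [dirichlet_ae_mem_stdSimplex hα hN] with p hp
        refine ENNReal.ofReal_le_ofReal ?_
        have h1 := hKw m _ hmm.1 hmm.2 (hconv p hp).1 (hconv p hp).2
        -- Young's inequality trades the deviation for the variance
        have h2 : |∑ i, p i * V i - m| ≤ δ + (∑ i, p i * V i - m) ^ 2 / δ := by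
          rw [← sq_abs, ← sub_nonneg]
          set y := |∑ i, p i * V i - m|
          have : δ + y ^ 2 / δ - y = ((y - δ) ^ 2 + y * δ) / δ := by field_simp; ring
          rw [this]
          have : 0 ≤ y := abs_nonneg _
          positivity
        have h3 := mul_le_mul_of_nonneg_left h2 hK
        linarith
    _ = ENNReal.ofReal (∫ p, (w m + K * (δ + (∑ i, p i * V i - m) ^ 2 / δ)) ∂dirichlet α) := by
        rw [ofReal_integral_eq_lintegral_ofReal hint2 (ae_of_all _ fun p => by
          have := hw0 m
          positivity)]
    _ ≤ ENNReal.ofReal (w m + K * (δ + s ^ 2 / (δ * (N + 1)))) := by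
        refine ENNReal.ofReal_le_ofReal ?_
        have hint3 : Integrable (fun p : ι → ℝ => δ + (∑ i, p i * V i - m) ^ 2 / δ)
            (dirichlet α) := (integrable_const δ).add (hint.div_const δ)
        rw [integral_add (integrable_const _) (hint3.const_mul K),
          integral_const_mul, integral_add (integrable_const _) (hint.div_const δ), integral_div]
        simp only [integral_const, probReal_univ, one_smul]
        rw [mul_comm δ (N + 1), ← div_div]
        gcongr
    _ ≤ _ := ENNReal.ofReal_add_le

theorem div_succ_le_sqrt {s N : ℝ} (hN : 0 < N) :
    s / (N + 1) ≤ √(s ^ 2 / (N * (N + 1))) := by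
  refine Real.le_sqrt_of_sq_le ?_
  rw [div_pow]
  gcongr
  nlinarith

/-- Comparison with an error term that decreases with `k`. Conditioning on one more draw from the
Pólya urn moves the mean by a centred variable with values in an interval of length `s / (N + 1)`,
which is dominated by a Gaussian variable of variance `s ^ 2 / N - s ^ 2 / (N + 1)`; after `k`
draws the concentration bound applies. -/
theorem lintegral_dirichlet_le_gaussian_add {V : ι → ℝ} {a s : ℝ} (hs : 0 < s)
    (hV : ∀ i, a ≤ V i) (hV' : ∀ i, V i ≤ a + s)
    {w : ℝ → ℝ} (hw : ConvexOn ℝ Set.univ w) (hw0 : ∀ x, 0 ≤ w x) {K : ℝ} (hK : 0 ≤ K)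
    (hKw : ∀ x y, a ≤ x → x ≤ a + s → a ≤ y → y ≤ a + s → w y ≤ w x + K * |y - x|)
    {δ : ℝ} (hδ : 0 < δ) (k : ℕ) {α : ι → ℝ} (hα : ∀ i, 0 ≤ α i) (hN : 0 < ∑ i, α i) :
    ∫⁻ p, ENNReal.ofReal (w (∑ i, p i * V i)) ∂dirichlet α ≤
      ∫⁻ x, ENNReal.ofReal (w x)
          ∂gaussianReal ((∑ i, α i * V i) / ∑ i, α i) (s ^ 2 / ∑ i, α i).toNNReal +
        ENNReal.ofReal (K * (δ + s ^ 2 / (δ * (∑ i, α i + k + 1)))) := by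
  classical
  induction k generalizing α with
  | zero =>
    rw [Nat.cast_zero, add_zero]
    refine (lintegral_dirichlet_le_mean_add hα hN hV hV' hw0 hK hKw hδ).trans ?_
    gcongr
    exact ofReal_le_lintegral_gaussian hw _ (by simpa using by positivity)
  | succ k ih =>
    have hwm : Measurable fun x => ENNReal.ofReal (w x) := hw.measurable_real.ennreal_ofReal
    have hwV : Measurable fun p : ι → ℝ => ENNReal.ofReal (w (∑ i, p i * V i)) :=
      hwm.comp (by fun_prop)
    rw [lintegral_dirichlet_eq_sum hα hN hwV]
    set N := ∑ i, α i with hNdef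
    set m := (∑ i, α i * V i) / N with hm
    set E := ENNReal.ofReal (K * (δ + s ^ 2 / (δ * (N + (k + 1 : ℕ) + 1)))) with hE
    have hq1 : ∑ o, α o / N = 1 := by rw [← Finset.sum_div, ← hNdef, div_self hN.ne']
    have hq0 : ∀ o, 0 ≤ α o / N := fun o => div_nonneg (hα o) hN.le
    set v₂ : NNReal := (s ^ 2 / (N + 1)).toNNReal with hv₂
    set v₁ : NNReal := (s ^ 2 / (N * (N + 1))).toNNReal with hv₁
    have hv1 : v₁ ≠ 0 := by
      have : 0 < s ^ 2 / (N * (N + 1)) := by positivity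
      simpa [hv₁] using this
    have hv : (s ^ 2 / N).toNNReal = v₁ + v₂ := by
      rw [hv₁, hv₂, ← Real.toNNReal_add (by positivity) (by positivity)]
      congr 1
      field_simp
      ring
    set z : ι → ℝ := fun o => (∑ i, α i * V i + V o) / (N + 1) with hz
    -- `z o` is the mean after the draw `o`; drawing `o` also raises the total mass to `N + 1`
    have hstep : ∀ o, ∫⁻ p, ENNReal.ofReal (w (∑ i, p i * V i))
        ∂dirichlet (α + Pi.single o (1 : ℝ)) ≤
        ∫⁻ y, ENNReal.ofReal (w (z o + y)) ∂gaussianReal 0 v₂ + E := fun o => by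
      have h := ih (add_single_nonneg hα o) (by rw [sum_add_single]; positivity)
      rw [sum_add_single, sum_add_single_mul, ← hNdef, ← hv₂] at h
      refine h.trans (le_of_eq ?_)
      congr 1
      · have e := gaussianReal_map_const_add (μ := 0) (v := v₂) (z o)
        rw [zero_add] at e
        rw [show (∑ i, α i * V i + V o) / (N + 1) = z o from rfl, ← e,
          lintegral_map hwm (by fun_prop)]
      · rw [hE]
        push_cast
        congr 5
        ring
    have hzm : ∑ o, α o / N * z o = m := by
      have e : ∀ o, α o / N * z o =
          ((α o / N) * ∑ i, α i * V i + (α o * V o) / N) / (N + 1) := fun o => by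
        simp only [hz]; field_simp
      simp_rw [e]
      rw [← Finset.sum_div, Finset.sum_add_distrib, ← Finset.sum_mul, hq1, ← Finset.sum_div, hm]
      field_simp
    have hspread : s / (N + 1) ≤ √(v₁ : ℝ) := by
      rw [hv₁, Real.coe_toNNReal _ (by positivity)]
      exact div_succ_le_sqrt hN
    calc ∑ o, ENNReal.ofReal (α o / N) *
          ∫⁻ p, ENNReal.ofReal (w (∑ i, p i * V i)) ∂dirichlet (α + Pi.single o (1 : ℝ))
        ≤ ∑ o, ENNReal.ofReal (α o / N) *
          (∫⁻ y, ENNReal.ofReal (w (z o + y)) ∂gaussianReal 0 v₂ + E) := by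
          gcongr with o; exact hstep o
      _ = ∫⁻ y, ENNReal.ofReal (∑ o, α o / N * w (z o + y)) ∂gaussianReal 0 v₂ + E := by
          simp_rw [mul_add]
          rw [Finset.sum_add_distrib, ← Finset.sum_mul,
            ← ENNReal.ofReal_sum_of_nonneg fun o _ => hq0 o, hq1, ENNReal.ofReal_one, one_mul]
          congr 1
          have hmo : ∀ o, Measurable fun y => ENNReal.ofReal (w (z o + y)) := fun o =>
            hwm.comp (by fun_prop)
          simp_rw [← lintegral_const_mul _ (hmo _)]
          rw [← lintegral_finsetSum _ fun o _ => (hmo o).const_mul _]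
          refine lintegral_congr fun y => ?_
          rw [ENNReal.ofReal_sum_of_nonneg fun o _ => mul_nonneg (hq0 o) (hw0 _)]
          exact Finset.sum_congr rfl fun o _ => (ENNReal.ofReal_mul (hq0 o)).symm
      _ ≤ ∫⁻ y, ∫⁻ x, ENNReal.ofReal (w (x + y)) ∂gaussianReal m v₁ ∂gaussianReal 0 v₂ + E := by
          gcongr with y
          -- for a fixed value `y` of the later Gaussian increments, compare the present draw with
          -- a Gaussian increment of variance `v₁`
          have hwy : ConvexOn ℝ Set.univ fun x => w (x + y) := by
            simpa [Function.comp_def] using hw.translate_left y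
          have h := sum_le_lintegral_gaussian hwy hv1 hq0 hq1 (z := z)
            (a := (∑ i, α i * V i + a) / (N + 1))
            (fun o => by simp only [hz]; gcongr; exact hV o)
            (fun o => by
              refine le_trans ?_ (add_le_add_right hspread _)
              rw [← add_div]
              exact div_le_div_of_nonneg_right (by linarith [hV' o]) (by positivity))
          rwa [hzm] at h
      _ = _ := by rw [hv, lintegral_gaussianReal_add hwm]

/-- Gaussian domination of Dirichlet averages: if the values `V i` lie in an interval of length
`s` and `p ∼ Dirichlet(α)` with total mass `N`, then `p ⬝ V` is dominated, in the convex order, by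
the Gaussian variable with the same mean and variance `s ^ 2 / N`. -/
theorem lintegral_dirichlet_le_gaussian {V : ι → ℝ} {a s : ℝ} (hs : 0 < s)
    (hV : ∀ i, a ≤ V i) (hV' : ∀ i, V i ≤ a + s)
    {w : ℝ → ℝ} (hw : ConvexOn ℝ Set.univ w) (hw0 : ∀ x, 0 ≤ w x)
    {α : ι → ℝ} (hα : ∀ i, 0 ≤ α i) (hN : 0 < ∑ i, α i) :
    ∫⁻ p, ENNReal.ofReal (w (∑ i, p i * V i)) ∂dirichlet α ≤
      ∫⁻ x, ENNReal.ofReal (w x)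
          ∂gaussianReal ((∑ i, α i * V i) / ∑ i, α i) (s ^ 2 / ∑ i, α i).toNNReal := by
  obtain ⟨K, hK, hKw⟩ := hw.exists_lipschitz_bound a (a + s)
  refine ENNReal.le_of_forall_pos_le_add fun ε hε _ => ?_
  have hε' : (0 : ℝ) < ε := hε
  -- `K + 1` instead of `K` keeps `δ` meaningful when `K = 0`; both error terms are then at most
  -- `ε / 2`
  set δ : ℝ := ε / (2 * (K + 1)) with hδ
  have hδ0 : 0 < δ := by positivity
  obtain ⟨k, hk⟩ := exists_nat_ge (s ^ 2 / δ ^ 2)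
  refine (lintegral_dirichlet_le_gaussian_add hs hV hV' hw hw0 hK hKw hδ0 k hα hN).trans ?_
  gcongr
  rw [← ENNReal.ofReal_coe_nnreal]
  refine ENNReal.ofReal_le_ofReal ?_
  have h1 : s ^ 2 / (δ * (∑ i, α i + k + 1)) ≤ δ := by
    rw [div_le_iff₀ (by positivity)] at hk ⊢
    nlinarith [sq_nonneg δ, mul_pos hN (pow_pos hδ0 2)]
  calc K * (δ + s ^ 2 / (δ * (∑ i, α i + k + 1))) ≤ (K + 1) * (δ + δ) := by gcongr; linarith
    _ = ε := by rw [hδ]; field_simp; ring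

end Polya

/-! ### The posterior law -/

section Posterior

theorem measurable_outcomeValue {X A : Type*} [Fintype A] [Nonempty A] (o : Outcome X) :
    Measurable fun Q : X → A → ℝ => outcomeValue Q o := by
  unfold outcomeValue
  refine measurable_const.add ?_
  have h := Finset.measurable_sup' (s := Finset.univ) (Finset.univ_nonempty (α := A))
    (f := fun a (Q : X → A → ℝ) => Q o.2 a) fun a _ => by fun_prop
  convert h using 1
  ext Q
  simp [Finset.sup'_apply]

/-- The law of the noise variables of one episode. -/
noncomputable abbrev noiseLaw (H : ℕ) (X A : Type*) [Fintype X] [Fintype A] :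
    Measure (Triple H X A → ℝ) := Measure.pi fun _ => gaussianReal 0 1

theorem lintegral_noise_mul {H n : ℕ} {X A : Type*} [Fintype X] [Fintype A]
    {f : (Fin n → Triple H X A → ℝ) → ℝ≥0∞} (hf : Measurable f)
    {g : (Triple H X A → ℝ) → ℝ≥0∞} (hg : Measurable g) :
    ∫⁻ ξ, f (fun k => ξ k.castSucc) * g (ξ (Fin.last n))
        ∂(Measure.pi fun _ : Fin (n + 1) => noiseLaw H X A) =
      (∫⁻ ξ, f ξ ∂Measure.pi fun _ => noiseLaw H X A) * ∫⁻ ξ, g ξ ∂noiseLaw H X A := by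
  have e := measurePreserving_piFinSuccAbove (fun _ : Fin (n + 1) => noiseLaw H X A) (Fin.last n)
  have h := e.lintegral_comp (f := fun p => f p.2 * g p.1) (by fun_prop)
  simp only [MeasurableEquiv.piFinSuccAbove_apply, Fin.insertNthEquiv_last] at h
  rw [lintegral_prod_symm' _ (by fun_prop)] at h
  simp_rw [lintegral_const_mul _ hg] at h
  rw [lintegral_mul_const _ hf] at h
  rw [← h]
  rfl


variable {H : ℕ} {X A : Type*}

theorem isProbabilityMeasure_priorLaw [Fintype X] [Fintype A] {α : Triple H X A → Outcome X → ℝ}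
    (hα : ∀ y o, 0 ≤ α y o) : IsProbabilityMeasure (priorLaw α) := by
  have := fun y => isProbabilityMeasure_dirichlet (hα y)
  exact Measure.pi.instIsProbabilityMeasure _

/-- The probability of the outcomes recorded in `h`, given the outcome distributions `M`. -/
noncomputable def historyLikelihood {n : ℕ} (M : Env H X A) (h : History H X A n) : ℝ≥0∞ :=
  ∏ i : Fin n × Fin H, ENNReal.ofReal
    (M (i.2, (h i.1).state i.2, (h i.1).action i.2) ((h i.1).outcome i.2))

theorem measurable_historyLikelihood {n : ℕ} (h : History H X A n) :
    Measurable fun M : Env H X A => historyLikelihood M h := by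
  unfold historyLikelihood; fun_prop

variable [DecidableEq X] [DecidableEq A]

/-- Conjugacy of the product of Dirichlet laws for one observation of the outcome `o` at `y`. -/
theorem priorLaw_withDensity_coord [Fintype X] [Fintype A] {α : Triple H X A → Outcome X → ℝ}
    (hα : ∀ y o, 0 ≤ α y o) (hN : ∀ y, 0 < ∑ o, α y o) (y : Triple H X A) (o : Outcome X) :
    (priorLaw α).withDensity (fun M => ENNReal.ofReal (M y o)) =
      ENNReal.ofReal (α y o / ∑ o, α y o) •
        priorLaw (α + Pi.single y (Pi.single o (1 : ℝ))) := by
  set α' : Triple H X A → Outcome X → ℝ := α + Pi.single y (Pi.single o (1 : ℝ)) with hαdef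
  have hα' : ∀ y' o', 0 ≤ α' y' o' := by
    intro y' o'
    by_cases h : y' = y
    · subst h; simpa [hαdef] using add_single_nonneg (hα y') o o'
    · simpa [hαdef, h] using hα y' o'
  have := fun y => isProbabilityMeasure_dirichlet (hα y)
  have := fun y => isProbabilityMeasure_dirichlet (hα' y)
  have h := pi_withDensity_prod (fun y => dirichlet (α y))
    (fun y' => dirichlet (α' y'))
    (f := fun i p => if i = y then ENNReal.ofReal (p o) else 1)
    (fun i => by split_ifs <;> fun_prop)
    (fun i => if i = y then ENNReal.ofReal (α i o / ∑ o, α i o) else 1)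
    (fun i => by split_ifs <;> simp) (fun i => by
      by_cases hi : i = y
      · subst hi
        simpa [hαdef] using dirichlet_withDensity_coord (hα i) (hN i) o
      · simp [hαdef, hi, withDensity_const])
  simp only [Finset.prod_ite_eq', Finset.mem_univ, if_true] at h
  exact h

/-- The Dirichlet parameters updated by the observations `(y i, o i)`, `i ∈ S`. -/
noncomputable def addObservations {κ : Type*} (α : Triple H X A → Outcome X → ℝ)
    (S : Finset κ) (y : κ → Triple H X A) (o : κ → Outcome X) : Triple H X A → Outcome X → ℝ :=
  α + ∑ i ∈ S, Pi.single (y i) (Pi.single (o i) (1 : ℝ))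

section AddObservations

variable {κ : Type*} {α : Triple H X A → Outcome X → ℝ}

theorem addObservations_apply (S : Finset κ) (y : κ → Triple H X A) (o : κ → Outcome X)
    (y' : Triple H X A) (o' : Outcome X) :
    addObservations α S y o y' o' =
      α y' o' + ∑ i ∈ S, if y i = y' then (Pi.single (o i) (1 : ℝ) : Outcome X → ℝ) o' else 0 := by
  simp only [addObservations, Pi.add_apply, Finset.sum_apply]
  congr 1
  refine Finset.sum_congr rfl fun i _ => ?_
  by_cases h : y i = y'
  · subst h; simp
  · simp [h, Ne.symm h]

theorem addObservations_nonneg (hα : ∀ y o, 0 ≤ α y o) (S : Finset κ) (y : κ → Triple H X A)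
    (o : κ → Outcome X) (y' : Triple H X A) (o' : Outcome X) :
    0 ≤ addObservations α S y o y' o' := by
  rw [addObservations_apply]
  refine add_nonneg (hα _ _) (Finset.sum_nonneg fun i _ => ?_)
  split_ifs
  · exact (Pi.single_nonneg (α := fun _ => ℝ) (i := o i)).mpr zero_le_one o'
  · exact le_rfl

variable [Fintype X]

theorem sum_addObservations_mul (S : Finset κ) (y : κ → Triple H X A) (o : κ → Outcome X)
    (y' : Triple H X A) (V : Outcome X → ℝ) :
    ∑ o', addObservations α S y o y' o' * V o' =
      ∑ o', α y' o' * V o' + ∑ i ∈ S, if y i = y' then V (o i) else 0 := by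
  simp_rw [addObservations_apply, add_mul, Finset.sum_mul]
  rw [Finset.sum_add_distrib, Finset.sum_comm]
  congr 1
  refine Finset.sum_congr rfl fun i _ => ?_
  by_cases h : y i = y' <;> simp [h, Pi.single_apply]

theorem sum_addObservations_pos (hN : ∀ y, 0 < ∑ o, α y o)
    (S : Finset κ) (y : κ → Triple H X A) (o : κ → Outcome X) (y' : Triple H X A) :
    0 < ∑ o', addObservations α S y o y' o' := by
  have h := sum_addObservations_mul (α := α) S y o y' fun _ => 1
  simp only [mul_one] at h
  rw [h]
  exact add_pos_of_pos_of_nonneg (hN y') (Finset.sum_nonneg fun i _ => by split_ifs <;> simp)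

/-- Conjugacy of the product of Dirichlet laws for finitely many observations. -/
theorem exists_priorLaw_withDensity_prod [Fintype A] (hα : ∀ y o, 0 ≤ α y o)
    (hN : ∀ y, 0 < ∑ o, α y o) (S : Finset κ) (y : κ → Triple H X A) (o : κ → Outcome X) :
    ∃ C : ℝ≥0∞, C ≠ ∞ ∧
      (priorLaw α).withDensity (fun M => ∏ i ∈ S, ENNReal.ofReal (M (y i) (o i))) =
        C • priorLaw (addObservations α S y o) := by
  classical
  induction S using Finset.induction_on with
  | empty => exact ⟨1, by simp, by simp [addObservations, withDensity_const]⟩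
  | insert i S hi ih =>
    obtain ⟨C, hC, h⟩ := ih
    set α' := addObservations α S y o with hα'
    refine ⟨C * ENNReal.ofReal (α' (y i) (o i) / ∑ o', α' (y i) o'),
      ENNReal.mul_ne_top hC ENNReal.ofReal_ne_top, ?_⟩
    have e : (fun M : Env H X A => ∏ j ∈ insert i S, ENNReal.ofReal (M (y j) (o j))) =
        (fun M => ∏ j ∈ S, ENNReal.ofReal (M (y j) (o j))) *
          fun M => ENNReal.ofReal (M (y i) (o i)) := by
      ext M; simp [Finset.prod_insert hi, mul_comm]
    rw [e, withDensity_mul _ (by fun_prop) (by fun_prop), h, withDensity_smul_measure,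
      priorLaw_withDensity_coord (addObservations_nonneg hα S y o)
        (sum_addObservations_pos hN S y o), smul_smul]
    congr 2
    rw [addObservations, addObservations, Finset.sum_insert hi, add_assoc,
      add_comm (Pi.single (y i) _)]

end AddObservations

/-- The parameters of the posterior law after observing the history `h`. -/
noncomputable def posteriorParam {n : ℕ} (α : Triple H X A → Outcome X → ℝ)
    (h : History H X A n) : Triple H X A → Outcome X → ℝ :=
  addObservations α (Finset.univ : Finset (Fin n × Fin H))
    (fun i => (i.2, (h i.1).state i.2, (h i.1).action i.2)) fun i => (h i.1).outcome i.2

theorem sum_posteriorParam_mul [Fintype X] {n : ℕ} (α : Triple H X A → Outcome X → ℝ)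
    (h : History H X A n) (y : Triple H X A) (V : Outcome X → ℝ) :
    ∑ o, posteriorParam α h y o * V o =
      ∑ o, α y o * V o + ∑ j ∈ visits h n y, V ((h j).outcome y.1) := by
  obtain ⟨t, x, a⟩ := y
  rw [posteriorParam, sum_addObservations_mul, visits, Finset.sum_filter]
  congr 1
  rw [Fintype.sum_prod_type]
  refine Finset.sum_congr rfl fun j _ => ?_
  rw [Finset.sum_eq_single t]
  · simp
  · intro s _ hs
    simp [hs]
  · simp

theorem sum_posteriorParam [Fintype X] {n : ℕ} (α : Triple H X A → Outcome X → ℝ)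
    (h : History H X A n) (y : Triple H X A) :
    ∑ o, posteriorParam α h y o = ∑ o, α y o + (visits h n y).card := by
  simpa using sum_posteriorParam_mul α h y fun _ => 1

variable [Fintype A] [Nonempty A]

/-- The probability of the initial states of `h`, times the indicator that the actions of `h` are
those selected by RLSVI with the noise variables `ξ`. -/
noncomputable def historyActionFactor {n : ℕ} (ρ : PMF X) (greedy : (A → ℝ) → A)
    (θbar : Triple H X A → ℝ) (v lam : ℝ) (ξ : Fin n → Triple H X A → ℝ)
    (h : History H X A n) : ℝ≥0∞ :=
  ∏ k : Fin n, (ρ (h k).1 * ∏ t, if (h k).action t =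
    rlsviPolicy greedy θbar v lam h (k : ℕ) (ξ k) t ((h k).state t) then 1 else 0)

variable {n : ℕ} (ρ : PMF X) (greedy : (A → ℝ) → A) (θbar : Triple H X A → ℝ) (v lam : ℝ)

theorem historyProb_eq (M : Env H X A) (ξ : Fin (n + 1) → Triple H X A → ℝ)
    (h : History H X A n) :
    historyProb ρ greedy θbar v lam M ξ h =
      historyActionFactor ρ greedy θbar v lam (fun k => ξ k.castSucc) h *
        historyLikelihood M h := by
  rw [historyProb, historyActionFactor, historyLikelihood, Fintype.prod_prod_type,
    ← Finset.prod_mul_distrib]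
  refine Finset.prod_congr rfl fun k _ => ?_
  rw [episodeProb, mul_assoc, ← Finset.prod_mul_distrib]
  simp only [ite_mul, one_mul, zero_mul]

theorem historyActionFactor_le_one (ξ : Fin n → Triple H X A → ℝ) (h : History H X A n) :
    historyActionFactor ρ greedy θbar v lam ξ h ≤ 1 := by
  refine Finset.prod_le_one' fun k _ => mul_le_one' (ρ.coe_le_one _)
    (Finset.prod_le_one' fun t _ => ?_)
  split_ifs <;> simp

theorem measurable_rlsviQ (h : History H X A n) (k : ℕ) (t : Fin (H + 1)) :
    Measurable fun ξ : Triple H X A → ℝ => rlsviQ θbar v lam h k ξ t := by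
  induction t using Fin.reverseInduction with
  | last => simp only [rlsviQ, Fin.reverseInduction_last]; exact measurable_const
  | cast t ih =>
    simp only [rlsviQ, Fin.reverseInduction_castSucc] at ih ⊢
    refine measurable_pi_lambda _ fun x => measurable_pi_lambda _ fun a => ?_
    unfold rlsviBellman
    have hV : ∀ o, Measurable fun ξ : Triple H X A → ℝ =>
        outcomeValue (rlsviQ θbar v lam h k ξ t.succ) o := fun o =>
      (measurable_outcomeValue o).comp ih
    simp only [rlsviQ] at hV
    fun_prop

theorem measurable_historyActionFactor [MeasurableSpace A] [MeasurableSingletonClass A]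
    (hg : Measurable greedy) (h : History H X A n) :
    Measurable fun ξ : Fin n → Triple H X A → ℝ =>
      historyActionFactor ρ greedy θbar v lam ξ h := by
  unfold historyActionFactor
  refine Finset.measurable_fun_prod _ fun k _ => measurable_const.mul
    (Finset.measurable_fun_prod _ fun t _ => Measurable.ite ?_ measurable_const measurable_const)
  have hpol : Measurable fun ξ : Fin n → Triple H X A → ℝ =>
      rlsviPolicy greedy θbar v lam h (k : ℕ) (ξ k) t ((h k).state t) := by
    unfold rlsviPolicy
    have hQ : Measurable fun ξ : Fin n → Triple H X A → ℝ =>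
        rlsviQ θbar v lam h (k : ℕ) (ξ k) t.castSucc :=
      (measurable_rlsviQ θbar v lam h k t.castSucc).comp (measurable_pi_apply k)
    exact hg.comp ((measurable_pi_apply _).comp hQ)
  have : {ξ : Fin n → Triple H X A → ℝ | (h k).action t =
      rlsviPolicy greedy θbar v lam h (k : ℕ) (ξ k) t ((h k).state t)} =
      (fun ξ : Fin n → Triple H X A → ℝ =>
        rlsviPolicy greedy θbar v lam h (k : ℕ) (ξ k) t ((h k).state t)) ⁻¹'
          {(h k).action t} := by
    ext; simp [eq_comm]
  rw [this]
  exact hpol (measurableSet_singleton _)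

end Posterior

/-! ### The model conditioned on a history -/

section PosteriorLaw

theorem measurable_of_countable_third {α β ι γ : Type*} [MeasurableSpace α] [MeasurableSpace β]
    [MeasurableSpace ι] [Countable ι] [MeasurableSingletonClass ι] [MeasurableSpace γ]
    {f : α → β → ι → γ} (hf : ∀ i, Measurable fun p : α × β => f p.1 p.2 i) :
    Measurable fun p : α × β × ι => f p.1 p.2.1 p.2.2 :=
  (measurable_from_prod_countable_left (f := fun q : (α × β) × ι => f q.1.1 q.1.2 q.2) hf).comp
    (g := fun q : (α × β) × ι => f q.1.1 q.1.2 q.2)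
    (f := fun p : α × β × ι => ((p.1, p.2.1), p.2.2)) (by fun_prop)

variable {H : ℕ} {X A : Type*} [Fintype X] [DecidableEq X] [Fintype A] [Nonempty A] [DecidableEq A]
  {n : ℕ} (ρ : PMF X) (greedy : (A → ℝ) → A) (θbar : Triple H X A → ℝ) (v lam : ℝ)

variable [MeasurableSpace X] [MeasurableSingletonClass X] [MeasurableSpace A]
  [MeasurableSingletonClass A]

theorem measurable_historyProb (hg : Measurable greedy) :
    Measurable fun ω : Env H X A × (Fin (n + 1) → Triple H X A → ℝ) × History H X A n =>
      historyProb ρ greedy θbar v lam ω.1 ω.2.1 ω.2.2 := by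
  refine measurable_of_countable_third fun h => ?_
  simp_rw [historyProb_eq]
  have hA := (measurable_historyActionFactor ρ greedy θbar v lam hg h).comp
    (show Measurable fun ω : Env H X A × (Fin (n + 1) → Triple H X A → ℝ) =>
      fun k : Fin n => ω.2 k.castSucc by fun_prop)
  exact hA.mul ((measurable_historyLikelihood h).comp measurable_fst)

variable {α₀ : Triple H X A → Outcome X → ℝ}

/-- On the event that the history is `h`, the likelihood separates into a factor of the outcome
distributions and a factor of the noise variables of the past episodes. -/
theorem setLIntegral_rlsviLaw (hα : ∀ y o, 0 ≤ α₀ y o) (hg : Measurable greedy)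
    (h : History H X A n) {ϕ : Env H X A → ℝ≥0∞} (hϕ : Measurable ϕ)
    {ψ : (Triple H X A → ℝ) → ℝ≥0∞} (hψ : Measurable ψ) :
    ∫⁻ ω in {ω | ω.2.2 = h}, ϕ ω.1 * ψ (ω.2.1 (Fin.last n))
        ∂rlsviLaw ρ greedy α₀ θbar v lam n =
      (∫⁻ M, historyLikelihood M h * ϕ M ∂priorLaw α₀) *
        ((∫⁻ ξ, historyActionFactor ρ greedy θbar v lam ξ h ∂Measure.pi fun _ => noiseLaw H X A) *
          ∫⁻ ξ, ψ ξ ∂noiseLaw H X A) := by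
  have := isProbabilityMeasure_priorLaw hα
  have hs : MeasurableSet {ω : Env H X A × (Fin (n + 1) → Triple H X A → ℝ) × History H X A n |
      ω.2.2 = h} := measurableSet_eq_fun (by fun_prop) measurable_const
  have hset : {ω : Env H X A × (Fin (n + 1) → Triple H X A → ℝ) × History H X A n | ω.2.2 = h} =
      Set.univ ×ˢ (Set.univ ×ˢ {h}) := by
    ext; simp
  have hm : Measurable fun ω : Env H X A × (Fin (n + 1) → Triple H X A → ℝ) × History H X A n =>
      ϕ ω.1 * ψ (ω.2.1 (Fin.last n)) := by fun_prop
  have hp := measurable_historyProb (n := n) ρ greedy θbar v lam hg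
  rw [rlsviLaw, setLIntegral_withDensity_eq_setLIntegral_mul _ hp hm hs, hset,
    ← Measure.prod_restrict, ← Measure.prod_restrict, Measure.restrict_univ, Measure.restrict_univ,
    Measure.restrict_singleton, Measure.count_singleton, one_smul,
    lintegral_prod _ (hp.mul hm).aemeasurable]
  have hA := measurable_historyActionFactor ρ greedy θbar v lam hg h
  have inner : ∀ M : Env H X A, ∫⁻ q, ((fun ω : Env H X A × (Fin (n + 1) → Triple H X A → ℝ) ×
      History H X A n => historyProb ρ greedy θbar v lam ω.1 ω.2.1 ω.2.2) *
      fun ω : Env H X A × (Fin (n + 1) → Triple H X A → ℝ) × History H X A n =>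
        ϕ ω.1 * ψ (ω.2.1 (Fin.last n))) (M, q)
      ∂((Measure.pi fun _ : Fin (n + 1) => noiseLaw H X A).prod (Measure.dirac h)) =
      (historyLikelihood M h * ϕ M) *
        ((∫⁻ ξ, historyActionFactor ρ greedy θbar v lam ξ h ∂Measure.pi fun _ => noiseLaw H X A) *
          ∫⁻ ξ, ψ ξ ∂noiseLaw H X A) := fun M => by
    have hMq : Measurable fun q => ((fun ω : Env H X A × (Fin (n + 1) → Triple H X A → ℝ) ×
        History H X A n => historyProb ρ greedy θbar v lam ω.1 ω.2.1 ω.2.2) *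
        fun ω : Env H X A × (Fin (n + 1) → Triple H X A → ℝ) × History H X A n =>
          ϕ ω.1 * ψ (ω.2.1 (Fin.last n))) (M, q) := (hp.mul hm).comp measurable_prodMk_left
    rw [Measure.prod_dirac, lintegral_map hMq (by fun_prop),
      ← lintegral_noise_mul hA hψ, ← lintegral_const_mul]
    · refine lintegral_congr fun ξ => ?_
      simp only [Pi.mul_apply, historyProb_eq]
      ring
    · exact (hA.comp (by fun_prop)).mul (hψ.comp (by fun_prop))
  rw [lintegral_congr inner, lintegral_mul_const]
  exact (measurable_historyLikelihood h).mul hϕ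

/-- Given the history `h`, the outcome distributions and the noise variables of the next episode
are independent, the former distributed according to the updated Dirichlet laws and the latter
standard normal. -/
theorem lintegral_cond_rlsviLaw (hα : ∀ y o, 0 ≤ α₀ y o) (hN : ∀ y, 0 < ∑ o, α₀ y o)
    (hg : Measurable greedy) (h : History H X A n)
    (hpos : rlsviLaw ρ greedy α₀ θbar v lam n {ω | ω.2.2 = h} ≠ 0)
    {ϕ : Env H X A → ℝ≥0∞} (hϕ : Measurable ϕ)
    {ψ : (Triple H X A → ℝ) → ℝ≥0∞} (hψ : Measurable ψ) :
    ∫⁻ ω, ϕ ω.1 * ψ (ω.2.1 (Fin.last n))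
        ∂ProbabilityTheory.cond (rlsviLaw ρ greedy α₀ θbar v lam n) {ω | ω.2.2 = h} =
      (∫⁻ M, ϕ M ∂priorLaw (posteriorParam α₀ h)) * ∫⁻ ξ, ψ ξ ∂noiseLaw H X A := by
  obtain ⟨C, hC, hpost⟩ := exists_priorLaw_withDensity_prod hα hN
    (Finset.univ : Finset (Fin n × Fin H))
    (fun i => (i.2, (h i.1).state i.2, (h i.1).action i.2)) fun i => (h i.1).outcome i.2
  have := isProbabilityMeasure_priorLaw (α := posteriorParam α₀ h)
    (addObservations_nonneg hα _ _ _)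
  have hL : ∀ {ϕ : Env H X A → ℝ≥0∞}, Measurable ϕ →
      ∫⁻ M, historyLikelihood M h * ϕ M ∂priorLaw α₀ =
        C * ∫⁻ M, ϕ M ∂priorLaw (posteriorParam α₀ h) := fun {ϕ} hϕ => by
    have e := congrArg (fun μ => ∫⁻ M, ϕ M ∂μ) hpost
    beta_reduce at e
    rw [lintegral_withDensity_eq_lintegral_mul _ (by fun_prop) hϕ, lintegral_smul_measure] at e
    exact e
  set D := ∫⁻ ξ, historyActionFactor ρ greedy θbar v lam ξ h
    ∂Measure.pi fun _ => noiseLaw H X A with hD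
  have hD1 : D ≤ 1 := (lintegral_mono fun ξ =>
    historyActionFactor_le_one ρ greedy θbar v lam ξ h).trans (by simp)
  have hmass : rlsviLaw ρ greedy α₀ θbar v lam n {ω | ω.2.2 = h} = C * D := by
    have e := setLIntegral_rlsviLaw ρ greedy θbar v lam hα hg h
      (ϕ := fun _ => 1) measurable_const (ψ := fun _ => 1) measurable_const
    rw [hL measurable_const] at e
    simpa only [mul_one, lintegral_one, Measure.restrict_apply_univ, measure_univ] using e
  rw [ProbabilityTheory.cond, lintegral_smul_measure,
    setLIntegral_rlsviLaw ρ greedy θbar v lam hα hg h hϕ hψ, hL hϕ, smul_eq_mul]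
  rw [hmass] at hpos ⊢
  rw [← hD, mul_mul_mul_comm, ← mul_assoc, ENNReal.inv_mul_cancel hpos
    (ENNReal.mul_ne_top hC (ne_top_of_le_ne_top ENNReal.one_ne_top hD1)), one_mul]

end PosteriorLaw

/-! ### Stochastic optimism -/

section Optimism

theorem integrable_of_lintegral_ofReal_ne_top {Ω : Type*} [MeasurableSpace Ω] {μ : Measure Ω}
    {f : Ω → ℝ} (hf : Measurable f) (hpos : ∫⁻ x, ENNReal.ofReal (f x) ∂μ ≠ ∞)
    (hneg : ∫⁻ x, ENNReal.ofReal (-f x) ∂μ ≠ ∞) : Integrable f μ := by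
  refine ⟨hf.aestronglyMeasurable, ?_⟩
  have h : ∀ x, ‖f x‖ₑ ≤ ENNReal.ofReal (f x) + ENNReal.ofReal (-f x) := fun x => by
    rw [← ofReal_norm, Real.norm_eq_abs, ← max_zero_add_max_neg_zero_eq_abs_self,
      ENNReal.ofReal_add (le_max_right _ _) (le_max_right _ _)]
    simp
  refine (lintegral_mono h).trans_lt ?_
  rw [lintegral_add_left hf.ennreal_ofReal]
  exact ENNReal.add_lt_top.mpr ⟨hpos.lt_top, hneg.lt_top⟩

theorem lintegral_ofReal_neg_ne_top_of_affine_le {μ : Measure ℝ} [IsFiniteMeasure μ]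
    (hμ : Integrable (fun x : ℝ => x) μ) {u : ℝ → ℝ} {A B : ℝ} (h : ∀ x, A + B * x ≤ u x) :
    ∫⁻ x, ENNReal.ofReal (-u x) ∂μ ≠ ∞ := by
  have hi : Integrable (fun x => -(A + B * x)) μ :=
    ((integrable_const A).add (hμ.const_mul B)).neg
  refine ne_top_of_le_ne_top hi.lintegral_lt_top.ne (lintegral_mono fun x => ?_)
  exact ENNReal.ofReal_le_ofReal (neg_le_neg (h x))

theorem extExpectation_of_integrable {Ω : Type*} [MeasurableSpace Ω] {μ : Measure Ω} {f : Ω → ℝ}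
    (hf : Integrable f μ) : extExpectation μ f = ((∫ x, f x ∂μ : ℝ) : EReal) := by
  rw [integral_eq_lintegral_pos_part_sub_lintegral_neg_part hf, EReal.coe_sub, extExpectation,
    EReal.coe_ennreal_toReal hf.lintegral_lt_top.ne,
    EReal.coe_ennreal_toReal
      (show ∫⁻ x, ENNReal.ofReal (-f x) ∂μ ≠ ∞ from hf.neg.lintegral_lt_top.ne)]

theorem integral_affine_of_integral_eq {Ω : Type*} [MeasurableSpace Ω] {μ : Measure Ω}
    [IsProbabilityMeasure μ] {f : Ω → ℝ} (hf : Integrable f μ) {m : ℝ} (hm : ∫ x, f x ∂μ = m)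
    (A k : ℝ) : ∫ x, (A + k * (f x - m)) ∂μ = A := by
  have h : Integrable (fun x => f x - m) μ := hf.sub (integrable_const m)
  rw [integral_add (integrable_const _) (h.const_mul k), integral_const_mul,
    integral_sub hf (integrable_const m), hm]
  simp

variable {ι : Type*} [Fintype ι]

/-- For convex `u` the Dirichlet average has expected utility at most that of the Gaussian variable
with the same mean and variance `s ^ 2 / N`. The nonnegative comparison is applied to `u` minus its
supporting line at the common mean. -/
theorem integral_dirichlet_le_integral_gaussian {V : ι → ℝ} {a s : ℝ} (hs : 0 < s)
    (hV : ∀ i, a ≤ V i) (hV' : ∀ i, V i ≤ a + s)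
    {u : ℝ → ℝ} (hu : ConvexOn ℝ Set.univ u)
    {α : ι → ℝ} (hα : ∀ i, 0 ≤ α i) (hN : 0 < ∑ i, α i)
    (hint : Integrable u
      (gaussianReal ((∑ i, α i * V i) / ∑ i, α i) (s ^ 2 / ∑ i, α i).toNNReal)) :
    ∫ p, u (∑ i, p i * V i) ∂dirichlet α ≤
      ∫ x, u x ∂gaussianReal ((∑ i, α i * V i) / ∑ i, α i) (s ^ 2 / ∑ i, α i).toNNReal := by
  have := isProbabilityMeasure_dirichlet hα
  have hmean := integral_dirichlet_sum_mul hα hN V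
  set m := (∑ i, α i * V i) / ∑ i, α i with hm
  set Γ := gaussianReal m (s ^ 2 / ∑ i, α i).toNNReal with hΓ
  obtain ⟨k, hk⟩ := hu.exists_supporting_slope m
  have hid : Integrable (fun x : ℝ => x) Γ := integrable_id_gaussianReal _ _
  have hcu : Continuous u := hu.locallyLipschitz.continuous
  set w : ℝ → ℝ := fun x => u x - (u m + k * (x - m)) with hw
  have hw0 : ∀ x, 0 ≤ w x := fun x => sub_nonneg.mpr (hk x)
  have hwc : ConvexOn ℝ Set.univ w := by
    refine hu.sub ⟨convex_univ, fun x _ y _ a b _ _ hab => ?_⟩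
    simp only [smul_eq_mul]
    have : b = 1 - a := by linarith
    subst this
    exact le_of_eq (by ring)
  have hcw : Continuous w := by fun_prop
  have key := lintegral_dirichlet_le_gaussian hs hV hV' hwc hw0 hα hN
  have hl : Integrable (fun x => u m + k * (x - m)) Γ :=
    (integrable_const _).add ((hid.sub (integrable_const m)).const_mul k)
  have hwΓ : Integrable w Γ := hint.sub hl
  have hVi : Integrable (fun p : ι → ℝ => ∑ i, p i * V i) (dirichlet α) :=
    integrable_dirichlet_of_continuous hα hN (by fun_prop)
  have huD : Integrable (fun p : ι → ℝ => u (∑ i, p i * V i)) (dirichlet α) :=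
    integrable_dirichlet_of_continuous hα hN (by fun_prop)
  have hwD : Integrable (fun p : ι → ℝ => w (∑ i, p i * V i)) (dirichlet α) :=
    integrable_dirichlet_of_continuous hα hN (by fun_prop)
  have hlD : Integrable (fun p : ι → ℝ => u m + k * (∑ i, p i * V i - m)) (dirichlet α) :=
    integrable_dirichlet_of_continuous hα hN (by fun_prop)
  rw [← ofReal_integral_eq_lintegral_ofReal hwΓ (ae_of_all _ hw0),
    ← ofReal_integral_eq_lintegral_ofReal hwD (ae_of_all _ fun p => hw0 _),
    ENNReal.ofReal_le_ofReal_iff (integral_nonneg hw0)] at key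
  have e1 : ∫ x, w x ∂Γ = ∫ x, u x ∂Γ - u m := by
    simp only [hw]
    rw [integral_sub hint hl,
      integral_affine_of_integral_eq hid (by rw [hΓ, integral_id_gaussianReal])]
  have e2 : ∫ p, w (∑ i, p i * V i) ∂dirichlet α =
      ∫ p, u (∑ i, p i * V i) ∂dirichlet α - u m := by
    simp only [hw]
    rw [integral_sub huD hlD, integral_affine_of_integral_eq hVi hmean]
  linarith

/-- A Gaussian law with variance `s ^ 2 / N` and a mean at least that of the Dirichlet average is
stochastically optimistic with respect to it. -/
theorem extExpectation_dirichlet_le_gaussian {V : ι → ℝ} {a s : ℝ} (hs : 0 < s)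
    (hV : ∀ i, a ≤ V i) (hV' : ∀ i, V i ≤ a + s)
    {u : ℝ → ℝ} (hu : ConvexOn ℝ Set.univ u) (humono : Monotone u)
    {α : ι → ℝ} (hα : ∀ i, 0 ≤ α i) (hN : 0 < ∑ i, α i) {m' : ℝ}
    (hm' : (∑ i, α i * V i) / ∑ i, α i ≤ m') :
    ∫⁻ x, ENNReal.ofReal (-u x) ∂gaussianReal m' (s ^ 2 / ∑ i, α i).toNNReal ≠ ∞ ∧
    ∫⁻ p, ENNReal.ofReal (-u (∑ i, p i * V i)) ∂dirichlet α ≠ ∞ ∧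
    extExpectation (dirichlet α) (fun p => u (∑ i, p i * V i)) ≤
      extExpectation (gaussianReal m' (s ^ 2 / ∑ i, α i).toNNReal) u := by
  have hcu : Continuous u := hu.locallyLipschitz.continuous
  have huD : Integrable (fun p : ι → ℝ => u (∑ i, p i * V i)) (dirichlet α) :=
    integrable_dirichlet_of_continuous hα hN (by fun_prop)
  obtain ⟨k, hk⟩ := hu.exists_supporting_slope 0
  have hneg : ∫⁻ x, ENNReal.ofReal (-u x) ∂gaussianReal m' (s ^ 2 / ∑ i, α i).toNNReal ≠ ∞ :=
    lintegral_ofReal_neg_ne_top_of_affine_le (integrable_id_gaussianReal _ _) (A := u 0) (B := k)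
      fun x => by simpa using hk x
  refine ⟨hneg, huD.neg.lintegral_lt_top.ne, ?_⟩
  -- an infinite positive part makes the Gaussian side equal to `⊤`
  by_cases hpos : ∫⁻ x, ENNReal.ofReal (u x) ∂gaussianReal m' (s ^ 2 / ∑ i, α i).toNNReal = ∞
  · rw [extExpectation, extExpectation, hpos]
    lift ∫⁻ x, ENNReal.ofReal (-u x) ∂gaussianReal m' (s ^ 2 / ∑ i, α i).toNNReal to NNReal
      using hneg with c
    rw [EReal.coe_ennreal_top, show (((c : ℝ≥0∞) : EReal)) = ((c : ℝ) : EReal) from rfl,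
      EReal.top_sub_coe]
    exact le_top
  have hint := integrable_of_lintegral_ofReal_ne_top hcu.measurable hpos hneg
  rw [extExpectation_of_integrable huD, extExpectation_of_integrable hint, EReal.coe_le_coe_iff]
  set m := (∑ i, α i * V i) / ∑ i, α i with hm
  have hmap := gaussianReal_map_add_const (μ := m) (v := (s ^ 2 / ∑ i, α i).toNNReal) (m' - m)
  rw [add_sub_cancel] at hmap
  have hu' : ConvexOn ℝ Set.univ fun x => u (x + (m' - m)) := by
    simpa [Function.comp_def] using hu.translate_left (m' - m)
  have hint' : Integrable (fun x => u (x + (m' - m)))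
      (gaussianReal m (s ^ 2 / ∑ i, α i).toNNReal) := by
    rw [← hmap] at hint
    exact hint.comp_measurable (by fun_prop)
  have h := integral_dirichlet_le_integral_gaussian hs hV hV' hu' hα hN hint'
  calc ∫ p, u (∑ i, p i * V i) ∂dirichlet α
      ≤ ∫ p, u (∑ i, p i * V i + (m' - m)) ∂dirichlet α :=
        integral_mono huD (integrable_dirichlet_of_continuous hα hN (by fun_prop))
          fun p => humono (by linarith)
    _ ≤ _ := h
    _ = _ := by
        rw [← hmap, integral_map (by fun_prop) hcu.aestronglyMeasurable]

theorem map_gaussianReal_affine (c : ℝ) (σ2 : ℝ) (hσ : 0 ≤ σ2) :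
    (gaussianReal 0 1).map (fun x => c + √σ2 * x) = gaussianReal c σ2.toNNReal := by
  have h := congrArg (Measure.map (fun x => c + x))
    (gaussianReal_map_const_mul (μ := 0) (v := 1) √σ2)
  rw [Measure.map_map (by fun_prop) (by fun_prop), gaussianReal_map_const_add] at h
  rw [show (fun x => c + √σ2 * x) = (fun x => c + x) ∘ fun x => √σ2 * x from rfl, h]
  congr 1
  · simp
  · ext; simp [Real.sq_sqrt hσ, hσ]

end Optimism

/-- The RLSVI Bellman update of a fixed `Q` is stochastically optimistic with respect to the true
Bellman update, conditionally on the history of the first `n` episodes (the episode under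
consideration being number `n`, counted from `0`). -/
theorem mainTheorem3 {X A : Type*} [Fintype X] [Nonempty X] [DecidableEq X] [MeasurableSpace X]
    [MeasurableSingletonClass X] [Fintype A] [Nonempty A] [DecidableEq A] [MeasurableSpace A]
    [MeasurableSingletonClass A] (H : ℕ)
    (ρ : PMF X) (greedy : (A → ℝ) → A) (hgreedy : ∀ (q : A → ℝ) (a : A), q a ≤ q (greedy q))
    (hgreedy_meas : Measurable greedy)
    (α₀ : Triple H X A → Outcome X → ℝ) (β : ℝ) (hβ : 2 ≤ β)
    (hα₀ : ∀ y o, 0 ≤ α₀ y o) (hα₀_sum : ∀ y, ∑ o, α₀ y o = β)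
    (θbar : Triple H X A → ℝ) (v lam : ℝ) (hv : 0 < v) (hlam : 0 < lam) (hvlam : v / lam = β)
    (n : ℕ) (h : History H X A n)
    (hpos : rlsviLaw ρ greedy α₀ θbar v lam n {ω | ω.2.2 = h} ≠ 0)
    (t : Fin H) (x : X) (a : A) (Q : X → A → ℝ)
    (hspan : valueSpan (outcomeValue Q) ^ 2 ≤ v)
    (hmax : ∀ y, Finset.univ.sup' Finset.univ_nonempty (outcomeValue Q) ≤ θbar y) :
    StochOptimistic (ProbabilityTheory.cond (rlsviLaw ρ greedy α₀ θbar v lam n) {ω | ω.2.2 = h})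
      (fun ω => rlsviBellman θbar v lam ω.2.2 n (ω.2.1 (Fin.last n)) t Q x a)
      (fun ω => trueBellman ω.1 t Q x a) := by
  have hβ0 : 0 < β := by linarith
  have hN0 : ∀ y, 0 < ∑ o, α₀ y o := fun y => by rw [hα₀_sum]; exact hβ0
  set μ := rlsviLaw ρ greedy α₀ θbar v lam n with hμ
  set y : Triple H X A := (t, x, a) with hy
  set V := outcomeValue Q with hVdef
  set α := posteriorParam α₀ h y with hαdef
  set c : ℝ := ((visits h n y).card : ℝ) with hc
  have hα : ∀ o, 0 ≤ α o := addObservations_nonneg hα₀ _ _ _ y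
  have hsum : ∑ o, α o = β + c := by rw [hαdef, sum_posteriorParam, hα₀_sum]
  have hc0 : 0 ≤ c := Nat.cast_nonneg _
  have hN : 0 < ∑ o, α o := by rw [hsum]; positivity
  have hs : 0 < √v := Real.sqrt_pos.mpr hv
  have hVlow : ∀ o, Finset.univ.inf' Finset.univ_nonempty V ≤ V o := fun o =>
    Finset.inf'_le _ (Finset.mem_univ o)
  have hVsup : ∀ o, V o ≤ Finset.univ.sup' Finset.univ_nonempty V := fun o =>
    Finset.le_sup' _ (Finset.mem_univ o)
  have hVhigh : ∀ o, V o ≤ Finset.univ.inf' Finset.univ_nonempty V + √v := fun o => by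
    have h1 : valueSpan V ≤ √v := (le_abs_self _).trans (Real.abs_le_sqrt hspan)
    rw [valueSpan] at h1
    linarith [hVsup o]
  have hvar : noiseVar v lam h n y = √v ^ 2 / ∑ o, α o := by
    rw [noiseVar, hsum, Real.sq_sqrt hv.le, ← hvlam, ← hc]
    field_simp
  set m' : ℝ := noiseVar v lam h n y *
    (θbar y / lam + (1 / v) * ∑ j ∈ visits h n y, V ((h j).outcome t)) with hm'
  have hmean : (∑ o, α o * V o) / ∑ o, α o ≤ m' := by
    have e : m' = (β * θbar y + ∑ j ∈ visits h n y, V ((h j).outcome t)) / ∑ o, α o := by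
      rw [hm', hvar, Real.sq_sqrt hv.le, ← hvlam]
      field_simp
    rw [e, hαdef, sum_posteriorParam_mul]
    refine div_le_div_of_nonneg_right (add_le_add_left ?_ _) hN.le
    rw [← hα₀_sum y, Finset.sum_mul]
    exact Finset.sum_le_sum fun o _ =>
      mul_le_mul_of_nonneg_left ((hVsup o).trans (hmax y)) (hα₀ y o)
  have hσ : 0 ≤ noiseVar v lam h n y := by rw [hvar]; positivity
  have hs_meas : MeasurableSet {ω : Env H X A × (Fin (n + 1) → Triple H X A → ℝ) ×
      History H X A n | ω.2.2 = h} := measurableSet_eq_fun (by fun_prop) measurable_const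
  have hprior := isProbabilityMeasure_priorLaw (α := posteriorParam α₀ h)
    (addObservations_nonneg hα₀ _ _ _)
  have hdir : ∀ y, IsProbabilityMeasure (dirichlet (posteriorParam α₀ h y)) := fun y =>
    isProbabilityMeasure_dirichlet (addObservations_nonneg hα₀ _ _ _ y)
  -- given `h`, the true update has the law of `p ⬝ V` with `p ∼ Dirichlet(α)`, and the RLSVI
  -- update is Gaussian
  have hY : ∀ g : ℝ → ℝ≥0∞, Measurable g →
      ∫⁻ ω, g (trueBellman ω.1 t Q x a) ∂ProbabilityTheory.cond μ {ω | ω.2.2 = h} =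
        ∫⁻ p, g (∑ o, p o * V o) ∂dirichlet α := fun g hg => by
    have e := lintegral_cond_rlsviLaw ρ greedy θbar v lam hα₀ hN0 hgreedy_meas h hpos
      (ϕ := fun M => g (∑ o, M y o * V o)) (hg.comp (by fun_prop))
      (ψ := fun _ => 1) measurable_const
    simp only [mul_one, lintegral_one, measure_univ] at e
    refine e.trans ?_
    exact (measurePreserving_eval (fun y => dirichlet (posteriorParam α₀ h y)) y).lintegral_comp
      (f := fun p => g (∑ o, p o * V o)) (hg.comp (by fun_prop))
  have hX : ∀ g : ℝ → ℝ≥0∞, Measurable g →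
      ∫⁻ ω, g (rlsviBellman θbar v lam ω.2.2 n (ω.2.1 (Fin.last n)) t Q x a)
        ∂ProbabilityTheory.cond μ {ω | ω.2.2 = h} =
        ∫⁻ z, g z ∂gaussianReal m' (√v ^ 2 / ∑ o, α o).toNNReal := fun g hg => by
    have e := lintegral_cond_rlsviLaw ρ greedy θbar v lam hα₀ hN0 hgreedy_meas h hpos
      (ϕ := fun _ => 1) measurable_const
      (ψ := fun ξ => g (m' + √(noiseVar v lam h n y) * ξ y)) (hg.comp (by fun_prop))
    simp only [one_mul, lintegral_one, measure_univ] at e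
    rw [← hvar, ← map_gaussianReal_affine _ _ hσ, lintegral_map hg (by fun_prop)]
    refine Eq.trans ?_ (e.trans ?_)
    · refine lintegral_congr_ae ?_
      filter_upwards [ae_cond_mem hs_meas] with ω hω
      have hω' : ω.2.2 = h := hω
      rw [hω']
      rfl
    · exact (measurePreserving_eval (fun _ : Triple H X A => gaussianReal 0 1) y).lintegral_comp
        (f := fun z => g (m' + √(noiseVar v lam h n y) * z)) (hg.comp (by fun_prop))
  intro u hu humono
  have hum : Measurable u := hu.measurable_real
  have hfin := extExpectation_dirichlet_le_gaussian hs hVlow hVhigh hu humono hα hN hmean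
  simp only [extExpectation] at hfin ⊢
  rwa [hX (fun z => ENNReal.ofReal (-u z)) (by fun_prop),
    hY (fun z => ENNReal.ofReal (-u z)) (by fun_prop),
    hX (fun z => ENNReal.ofReal (u z)) (by fun_prop),
    hY (fun z => ENNReal.ofReal (u z)) (by fun_prop)]
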